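/- Let $\Phi_m=\sum_i\delta_{x_i}$ be a homogeneous Poisson point process on $\mathbb{R}^2$ with intensity $\lambda_m>0$ (the transmitters). Fix $y\in\mathbb{R}^2$ and give each transmitter $x_i$ a receiver at $x_i+y$. For $i,j$ and times $n\ge 1$ let $F_{i,j}(n)$ be the fading power on the link from $x_j$ to the receiver $x_i+y$; all the $F_{i,j}(n)$ are independent, $\mathrm{Exp}(1)$ distributed, and independent of $\Phi_m$, which does not change over time. Let the path loss be $\ell(r)=Ar^{\alpha}$ with $A>0$ and $\alpha>2$, let $\mathrm{SNR}^{-1}=\sigma^2/P_m\ge 0$ be the ratio of the noise power to the transmit power $P_m>0$, let $T>0$ be the detection threshold, $\tau_m\in\mathbb{N}$ the number of transmissions, and $$\mathrm{SINR}_i(n)=\frac{F_{i,i}(n)/\ell(\|y\|)}{\mathrm{SNR}^{-1}+\sum_{j\ne i}F_{i,j}(n)/\ell(\|x_j-(x_i+y)\|)}$$ (with values in $[0,\infty]$; if $y=0$, then $F/\ell(0)=\infty$ for $F>0$). The coverage probability at $y$ is the Palm probability that $\mathrm{SINR}(n)\ge T$ for at least one $n\in\{1,\dots,\tau_m\}$,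 that is, $$p(y)=\frac{1}{\lambda_m|B|}\,\mathbb{E}\Bigl[\#\bigl\{i: x_i\in B,\ \exists n\in\{1,\dots,\tau_m\}:\ \mathrm{SINR}_i(n)\ge T\bigr\}\Bigr]$$ for a bounded Borel set $B\subset\mathbb{R}^2$ of positive Lebesgue measure $|B|$. Then, for every such $B$, $$p(y)=\sum_{n=1}^{\tau_m}(-1)^{n+1}\binom{\tau_m}{n}\,e^{-nT\cdot\mathrm{SNR}^{-1}A\|y\|^{\alpha}}\;e^{-\lambda_mK(\alpha,n)T^{2/\alpha}\|y\|^2},$$ where $$K(\alpha,n)=\frac{2\pi}{\alpha}\int_0^\infty t^{-\frac{2}{\alpha}-1}\Bigl(1-\frac{1}{(1+t)^n}\Bigr)\,dt ,$$ the integral being convergent for all $n\in\{1,\dots,\tau_m\}$. -/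

import Mathlib

open MeasureTheory ProbabilityTheory Set
open scoped NNReal ENNReal

noncomputable section

/-- The Euclidean plane, with its Euclidean norm and Lebesgue measure `volume`. -/
abbrev Plane : Type := EuclideanSpace ℝ (Fin 2)

/-- The number of points of the point process `∑ i, δ_{X i}` that lie in `B`. -/
def pointCount {Ω : Type*} (X : ℕ → Ω → Plane) (B : Set Plane) (ω : Ω) : ℝ≥0∞ :=
  ∑' i, B.indicator 1 (X i ω)

/-- `∑ i, δ_{X i}` is a homogeneous Poisson point process on the plane with intensity `lam`
(points per unit area). Its points are enumerated by `ℕ`, which is no restriction for `0 < lam`,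
because the total number of points is then almost surely infinite. -/
structure IsPoissonProcess {Ω : Type*} [MeasurableSpace Ω] (P : Measure Ω)
    (X : ℕ → Ω → Plane) (lam : ℝ≥0) : Prop where
  measurable_point : ∀ i, Measurable (X i)
  /-- The number of points in a set of finite area is Poisson distributed. -/
  map_count : ∀ B : Set Plane, MeasurableSet B → volume B ≠ ∞ →
    P.map (pointCount X B) =
      (poissonMeasure (lam * (volume B).toNNReal)).map (fun k : ℕ => (k : ℝ≥0∞))
  /-- The numbers of points in disjoint sets are independent. -/
  indep_count : ∀ (m : ℕ) (B : Fin m → Set Plane), (∀ k, MeasurableSet (B k)) →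
    Pairwise (fun k l => Disjoint (B k) (B l)) →
    iIndepFun (fun k => pointCount X (B k)) P

/-- The multicast network: transmitters at the points `X i` of a Poisson point process of
intensity `lam`, and for each cluster `i` (the receiver of transmitter `X i`), each transmitter
`j` and each transmission time `n` the power `F i j n` of the Rayleigh fading on the link
from `X j` to the receiver of cluster `i`. All fading powers are independent `Exp(1)` variables,
independent of the transmitter positions (which stay fixed over time). -/
structure IsMulticastNetwork {Ω : Type*} [MeasurableSpace Ω] (P : Measure Ω)
    (X : ℕ → Ω → Plane) (F : ℕ → ℕ → ℕ → Ω → ℝ) (lam : ℝ≥0) : Prop where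
  poisson : IsPoissonProcess P X lam
  measurable_fading : ∀ i j n, Measurable (F i j n)
  map_fading : ∀ i j n, P.map (F i j n) = expMeasure 1
  indep_fading : iIndepFun (fun q : ℕ × ℕ × ℕ => F q.1 q.2.1 q.2.2) P
  indep_position_fading :
    IndepFun (fun ω (i : ℕ) => X i ω) (fun ω (q : ℕ × ℕ × ℕ) => F q.1 q.2.1 q.2.2 ω) P

/-- The signal to interference plus noise ratio, at time `n`, of the link from transmitter `X i`
to its receiver at the position `X i + y`, for the path loss function `loss` and the ratio
`invSNR` of noise power to transmit power. The computation in `[0, ∞]` means that no convention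
about divergent series enters: an infinite interference gives the value that it should. -/
def sinr {Ω : Type*} (loss : ℝ → ℝ) (invSNR : ℝ) (X : ℕ → Ω → Plane)
    (F : ℕ → ℕ → ℕ → Ω → ℝ) (y : Plane) (i n : ℕ) (ω : Ω) : ℝ≥0∞ :=
  (ENNReal.ofReal (F i i n ω) / ENNReal.ofReal (loss ‖y‖)) /
    (ENNReal.ofReal invSNR +
      ∑' j : {j : ℕ // j ≠ i},
        ENNReal.ofReal (F i j n ω) / ENNReal.ofReal (loss ‖X j ω - (X i ω + y)‖))

/-- The event that the receiver at `X i + y` is covered by its transmitter `X i`: in at least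
one of the `tau` transmissions the ratio reaches the threshold `T`. -/
def coveredEvent {Ω : Type*} (loss : ℝ → ℝ) (invSNR T : ℝ) (tau : ℕ) (X : ℕ → Ω → Plane)
    (F : ℕ → ℕ → ℕ → Ω → ℝ) (y : Plane) (i : ℕ) : Set Ω :=
  ⋃ n ∈ Finset.Icc 1 tau, {ω | ENNReal.ofReal T ≤ sinr loss invSNR X F y i n ω}

/-- Palm probability for the stationary point process `∑ i, δ_{X i}` of intensity `lam`: the
mean number of points in the window `B` from which the event holds, over the mean number
`lam * |B|` of points in `B`. Here `E i` is the event as seen from the point `X i`. -/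
def palmProb {Ω : Type*} [MeasurableSpace Ω] (P : Measure Ω) (X : ℕ → Ω → Plane) (lam : ℝ≥0)
    (B : Set Plane) (E : ℕ → Set Ω) : ℝ≥0∞ :=
  (∫⁻ ω, ∑' i, B.indicator 1 (X i ω) * (E i).indicator 1 ω ∂P) / (lam * volume B)

/-- The integrand of the constant `K(α, n)`. -/
def integrandK (α : ℝ) (n : ℕ) (t : ℝ) : ℝ :=
  t ^ (-(2 / α) - 1) * (1 - 1 / (1 + t) ^ n)

/-- `K(α, n) = (2π/α) ∫_0^∞ t^(-2/α-1) (1 - (1+t)^(-n)) dt`. -/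
def constK (α : ℝ) (n : ℕ) : ℝ :=
  2 * Real.pi / α * ∫ t in Ioi (0 : ℝ), integrandK α n t

end

/-! Fix the transmitter positions. At the receiver of `X i`, the events of success in the different
transmissions are then independent with a common probability `c`, so coverage has conditional
probability `1 - (1 - c) ^ tau`, an alternating sum of powers `c ^ n`. The positions do not change
between transmissions, so what has to be averaged is `c ^ n`, and not the `n`-th power of the mean
of `c`.

For `y ≠ 0` put `θ = T * A * ‖y‖ ^ α`. The exponential tail of the signal and the Laplace transform
of the interfering powers give `c = exp (-θ s) * ∏_{j ≠ i} (1 + θ / ℓ)⁻¹`, where `s` is the noise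
ratio and `ℓ` the loss from `X j` to the receiver (`coverProb_eq_signalProb`). Hence `c ^ n` is an
exponential functional of the points other than `X i`, seen from `X i`. Its mean per point of `B` is
`exp (-n θ s) * exp (-lam * ∫ (1 - (1 + θ / ℓ)⁻ⁿ))`; polar coordinates turn the integral into
`constK α n * (θ / A) ^ (2 / α)` (`integral_and_integrable_radial`).

The mean is derived from the counts alone. Independent Poisson counts give the Laplace functional
(`laplace`), and its derivative in the direction of an indicator gives a Mecke formula for a fixed
`φ` (`mecke_negExp`). To recentre `φ` at `X i`, the centre is replaced by a finitely valued
approximation, translation invariance is used on each piece, and limits are taken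
(`lintegral_campbellMeasure_interference`). Sums and exponents live in `[0, ∞]`, so infinite
interference needs no separate treatment. -/

/-- The function `a ↦ e ^ (-a)` on `[0, ∞]`, with `e ^ (-∞) = 0`. -/
noncomputable def negExp (a : ℝ≥0∞) : ℝ≥0∞ := (EReal.exp (a : EReal))⁻¹

/-- The logarithm as a function `[0, ∞] → [0, ∞]`, truncated at `0`. -/
noncomputable def posLog (u : ℝ≥0∞) : ℝ≥0∞ := (ENNReal.log u).toENNReal

/-! ### Exponential and logarithm on `[0, ∞]`. -/

section NegExp

open Filter Topology

@[simp] lemma negExp_zero : negExp 0 = 1 := by simp [negExp]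

@[simp] lemma negExp_top : negExp ∞ = 0 := by simp [negExp]

lemma one_le_exp_coe (a : ℝ≥0∞) : 1 ≤ EReal.exp (a : EReal) := by
  simpa using EReal.coe_ennreal_nonneg a

lemma negExp_add (a b : ℝ≥0∞) : negExp (a + b) = negExp a * negExp b := by
  have h (c : ℝ≥0∞) : EReal.exp (c : EReal) ≠ 0 :=
    (zero_lt_one.trans_le (one_le_exp_coe c)).ne'
  simp only [negExp, EReal.coe_ennreal_add, EReal.exp_add]
  rw [ENNReal.mul_inv (Or.inl (h a)) (Or.inr (h b))]

lemma negExp_antitone : Antitone negExp := by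
  intro a b h
  simpa [negExp] using h

lemma negExp_le_one (a : ℝ≥0∞) : negExp a ≤ 1 := by
  simpa using negExp_antitone (zero_le (a := a))

lemma negExp_ne_top (a : ℝ≥0∞) : negExp a ≠ ∞ := ((negExp_le_one a).trans_lt (by simp)).ne

lemma continuous_negExp : Continuous negExp :=
  continuous_inv.comp (ENNReal.continuous_exp.comp continuous_coe_ennreal_ereal)

lemma measurable_negExp : Measurable negExp := continuous_negExp.measurable

lemma negExp_eq_zero_iff {a : ℝ≥0∞} : negExp a = 0 ↔ a = ∞ := by simp [negExp]

lemma negExp_ofReal {x : ℝ} (hx : 0 ≤ x) :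
    negExp (ENNReal.ofReal x) = ENNReal.ofReal (Real.exp (-x)) := by
  rw [negExp, EReal.coe_ennreal_ofReal, max_eq_left hx, EReal.exp_coe, Real.exp_neg,
    ENNReal.ofReal_inv_of_pos (Real.exp_pos x)]

lemma negExp_eq_ofReal {a : ℝ≥0∞} (ha : a ≠ ∞) :
    negExp a = ENNReal.ofReal (Real.exp (-a.toReal)) := by
  rw [← negExp_ofReal ENNReal.toReal_nonneg, ENNReal.ofReal_toReal ha]

lemma negExp_sum {ι : Type*} (s : Finset ι) (f : ι → ℝ≥0∞) :
    negExp (∑ i ∈ s, f i) = ∏ i ∈ s, negExp (f i) := by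
  classical
  induction s using Finset.induction_on with
  | empty => simp
  | insert a s ha ih => rw [Finset.sum_insert ha, Finset.prod_insert ha, negExp_add, ih]

lemma negExp_nat_mul (n : ℕ) (a : ℝ≥0∞) : negExp (n * a) = negExp a ^ n := by
  simpa using negExp_sum (Finset.range n) (fun _ => a)

lemma tendsto_prod_negExp (f : ℕ → ℝ≥0∞) :
    Tendsto (fun m => ∏ i ∈ Finset.range m, negExp (f i)) atTop (𝓝 (negExp (∑' i, f i))) := by
  simp_rw [← negExp_sum]
  exact (continuous_negExp.tendsto _).comp (ENNReal.tendsto_nat_tsum f)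

lemma continuous_posLog : Continuous posLog :=
  EReal.continuous_toENNReal.comp ENNReal.continuous_log

lemma posLog_mono : Monotone posLog := fun _ _ h =>
  EReal.toENNReal_le_toENNReal (ENNReal.log_monotone h)

lemma negExp_posLog {u : ℝ≥0∞} (hu : 1 ≤ u) : negExp (posLog u) = u⁻¹ := by
  rw [negExp, posLog, EReal.coe_toENNReal (by simpa using hu), ENNReal.exp_log]

lemma posLog_one_add_le (u : ℝ≥0∞) : posLog (1 + u) ≤ u := by
  by_cases hu : u = ∞
  · simp [hu]
  · lift u to ℝ≥0 using hu
    have h : (0 : ℝ) < 1 + u := by positivity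
    have h1 : (1 : ℝ≥0∞) + u = ENNReal.ofReal (1 + u) := by
      rw [ENNReal.ofReal_add zero_le_one u.coe_nonneg]; simp
    rw [posLog, h1, ENNReal.log_ofReal_of_pos h]
    have h2 : ((Real.log (1 + u) : ℝ) : EReal) ≤ ((u : ℝ≥0∞) : EReal) := by
      have := Real.log_le_sub_one_of_pos h
      rw [EReal.coe_nnreal_eq_coe_real]
      exact_mod_cast (by linarith : Real.log (1 + u) ≤ u)
    simpa using EReal.toENNReal_le_toENNReal h2

lemma one_sub_negExp_le (a : ℝ≥0∞) : 1 - negExp a ≤ a := by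
  by_cases ha : a = ∞
  · simp [ha]
  rw [negExp_eq_ofReal ha, ← ENNReal.ofReal_one, ← ENNReal.ofReal_sub _ (Real.exp_pos _).le]
  refine ENNReal.ofReal_le_of_le_toReal ?_
  linarith [Real.add_one_le_exp (-a.toReal)]

end NegExp

/-! ### Generating function and mean of the Poisson law. -/

section Poisson

lemma lintegral_poissonMeasure (r : ℝ≥0) (f : ℕ → ℝ≥0∞) :
    ∫⁻ n, f n ∂(poissonMeasure r) =
      ∑' n : ℕ, ENNReal.ofReal (Real.exp (-r) * r ^ n / n.factorial) * f n := by
  rw [poissonMeasure, lintegral_sum_measure]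
  simp

/-- This is the probability generating function at `s = e ^ (-b)`; the value `b = ∞`, that is `s =
0`, is included. -/
lemma lintegral_negExp_poissonMeasure (r : ℝ≥0) (b : ℝ≥0∞) :
    ∫⁻ n, negExp (b * (n : ℝ≥0∞)) ∂(poissonMeasure r) = negExp (r * (1 - negExp b)) := by
  set s : ℝ := (negExp b).toReal with hs
  have hs0 : 0 ≤ s := ENNReal.toReal_nonneg
  have hs1 : s ≤ 1 := by
    simpa using ENNReal.toReal_mono ENNReal.one_ne_top (negExp_le_one b)
  have hb : negExp b = ENNReal.ofReal s := (ENNReal.ofReal_toReal (negExp_ne_top b)).symm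
  rw [lintegral_poissonMeasure]
  have h1 (n : ℕ) : ENNReal.ofReal (Real.exp (-r) * r ^ n / n.factorial) *
      negExp (b * (n : ℝ≥0∞)) =
      ENNReal.ofReal (Real.exp (-r) * ((r * s) ^ n / n.factorial)) := by
    rw [mul_comm b, negExp_nat_mul, hb, ← ENNReal.ofReal_pow hs0,
      ← ENNReal.ofReal_mul (by positivity)]
    congr 1
    rw [mul_pow]; ring
  simp_rw [h1]
  have h2 : HasSum (fun n : ℕ => Real.exp (-r) * ((r * s) ^ n / n.factorial))
      (Real.exp (-r) * Real.exp (r * s)) := by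
    have := (NormedSpace.expSeries_div_hasSum_exp (r * s : ℝ)).mul_left (Real.exp (-r))
    rwa [← Real.exp_eq_exp_ℝ] at this
  rw [← ENNReal.ofReal_tsum_of_nonneg (fun n => by positivity) h2.summable, h2.tsum_eq,
    ← Real.exp_add, hb, ← ENNReal.ofReal_one, ← ENNReal.ofReal_sub _ hs0,
    ← ENNReal.ofReal_coe_nnreal, ← ENNReal.ofReal_mul r.coe_nonneg,
    negExp_ofReal (mul_nonneg r.coe_nonneg (by linarith))]
  congr 2; ring

lemma lintegral_id_poissonMeasure (r : ℝ≥0) :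
    ∫⁻ n : ℕ, (n : ℝ≥0∞) ∂(poissonMeasure r) = r := by
  rw [lintegral_poissonMeasure, tsum_eq_zero_add' ENNReal.summable]
  have h1 (n : ℕ) : ENNReal.ofReal (Real.exp (-r) * r ^ (n + 1) / (n + 1).factorial) *
      ((n + 1 : ℕ) : ℝ≥0∞) = r * ENNReal.ofReal (Real.exp (-r) * r ^ n / n.factorial) := by
    rw [← ENNReal.ofReal_natCast, ← ENNReal.ofReal_mul (by positivity),
      ← ENNReal.ofReal_coe_nnreal, ← ENNReal.ofReal_mul r.coe_nonneg]
    congr 1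
    rw [Nat.factorial_succ]
    push_cast
    field_simp
    ring
  simp_rw [h1, ENNReal.tsum_mul_left]
  rw [← ENNReal.ofReal_tsum_of_nonneg (fun n => by positivity)
    (hasSum_one_poissonMeasure r).summable, (hasSum_one_poissonMeasure r).tsum_eq]
  simp

end Poisson

/-! ### Campbell's formula and the Laplace functional. -/

section PoissonProcess

open Filter Topology

variable {Ω : Type*} [MeasurableSpace Ω] {P : Measure Ω} {X : ℕ → Ω → Plane} {lam : ℝ≥0}

/-- The plane is a countable union of sets of finite area. Neither measure has to be known to be
σ-finite, which matters because the counts are controlled only on sets of finite area. -/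
lemma ext_of_finite_volume {μ ν : Measure Plane}
    (h : ∀ s, MeasurableSet s → volume s ≠ ∞ → μ s = ν s) : μ = ν := by
  refine Measure.ext_of_iUnion_eq_univ (iUnion_spanningSets (volume : Measure Plane)) fun n => ?_
  ext s hs
  rw [Measure.restrict_apply hs, Measure.restrict_apply hs]
  refine h _ (hs.inter (measurableSet_spanningSets _ n)) ?_
  exact ((measure_mono inter_subset_right).trans_lt (measure_spanningSets_lt_top _ n)).ne

lemma tendsto_tsum_of_monotone {ι : Type*} {f : ℕ → ι → ℝ≥0∞} {g : ι → ℝ≥0∞}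
    (hm : ∀ i, Monotone fun n => f n i) (ht : ∀ i, Tendsto (fun n => f n i) atTop (𝓝 (g i))) :
    Tendsto (fun n => ∑' i, f n i) atTop (𝓝 (∑' i, g i)) := by
  let : MeasurableSpace ι := ⊤
  simp_rw [← lintegral_count]
  exact lintegral_tendsto_of_tendsto_of_monotone (fun n => measurable_from_top.aemeasurable)
    (ae_of_all _ hm) (ae_of_all _ ht)

namespace IsPoissonProcess

lemma measurable_comp (hX : IsPoissonProcess P X lam) {f : Plane → ℝ≥0∞} (hf : Measurable f)
    (i : ℕ) : Measurable fun ω => f (X i ω) :=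
  hf.comp (hX.measurable_point i)

lemma measurable_tsum (hX : IsPoissonProcess P X lam) {f : Plane → ℝ≥0∞} (hf : Measurable f) :
    Measurable fun ω => ∑' i, f (X i ω) :=
  Measurable.tsum (hX.measurable_comp hf)

lemma measurable_pointCount (hX : IsPoissonProcess P X lam) {B : Set Plane}
    (hB : MeasurableSet B) : Measurable (pointCount X B) :=
  hX.measurable_tsum (measurable_one.indicator hB)

lemma lintegral_comp_pointCount (hX : IsPoissonProcess P X lam) {B : Set Plane}
    (hB : MeasurableSet B) (hfin : volume B ≠ ∞) {g : ℝ≥0∞ → ℝ≥0∞} (hg : Measurable g) :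
    ∫⁻ ω, g (pointCount X B ω) ∂P =
      ∫⁻ k : ℕ, g k ∂(poissonMeasure (lam * (volume B).toNNReal)) := by
  rw [← lintegral_map hg (hX.measurable_pointCount hB), hX.map_count B hB hfin,
    lintegral_map hg measurable_from_top]

lemma lintegral_pointCount (hX : IsPoissonProcess P X lam) {B : Set Plane}
    (hB : MeasurableSet B) (hfin : volume B ≠ ∞) :
    ∫⁻ ω, pointCount X B ω ∂P = lam * volume B := by
  rw [hX.lintegral_comp_pointCount hB hfin (g := fun x => x) measurable_id']
  simp only [lintegral_id_poissonMeasure, ENNReal.coe_mul, ENNReal.coe_toNNReal hfin]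

lemma lintegral_negExp_pointCount (hX : IsPoissonProcess P X lam) {B : Set Plane}
    (hB : MeasurableSet B) (hfin : volume B ≠ ∞) (b : ℝ≥0∞) :
    ∫⁻ ω, negExp (b * pointCount X B ω) ∂P = negExp (lam * ((1 - negExp b) * volume B)) := by
  rw [hX.lintegral_comp_pointCount hB hfin
    (g := fun x => negExp (b * x)) (measurable_negExp.comp (measurable_const_mul b)),
    lintegral_negExp_poissonMeasure, ENNReal.coe_mul, ENNReal.coe_toNNReal hfin]
  congr 1; ring

/-- Campbell's formula. -/
lemma lintegral_tsum (hX : IsPoissonProcess P X lam) {f : Plane → ℝ≥0∞} (hf : Measurable f) :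
    ∫⁻ ω, ∑' i, f (X i ω) ∂P = lam * ∫⁻ z, f z := by
  -- The laws of the individual points are unknown; only their sum, the intensity measure, is
  -- determined by the counts.
  have key : Measure.sum (fun i => P.map (X i)) = (lam : ℝ≥0∞) • (volume : Measure Plane) := by
    refine ext_of_finite_volume fun s hs hfin => ?_
    rw [Measure.sum_apply _ hs, Measure.smul_apply, smul_eq_mul,
      ← hX.lintegral_pointCount hs hfin]
    simp_rw [pointCount]
    rw [MeasureTheory.lintegral_tsum fun i =>
      (hX.measurable_comp (measurable_one.indicator hs) i).aemeasurable]
    congr 1; ext i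
    rw [← lintegral_map (measurable_one.indicator hs) (hX.measurable_point i),
      lintegral_indicator_one hs]
  rw [MeasureTheory.lintegral_tsum fun i => (hX.measurable_comp hf i).aemeasurable,
    ← smul_eq_mul, ← lintegral_smul_measure, ← key, lintegral_sum_measure]
  congr 1; ext i
  rw [lintegral_map hf (hX.measurable_point i)]

/-- The sum over the points is a combination of counts on the level sets of `φ`. These counts are
independent and Poisson, so the expectation factors. The value `0` is left out because its level set
may have infinite area; it contributes nothing to either side. -/
lemma laplace_simpleFunc (hX : IsPoissonProcess P X lam) (φ : SimpleFunc Plane ℝ≥0∞)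
    (hfin : ∀ b ≠ 0, volume (φ ⁻¹' {b}) ≠ ∞) :
    ∫⁻ ω, negExp (∑' i, φ (X i ω)) ∂P = negExp (lam * ∫⁻ z, (1 - negExp (φ z))) := by
  classical
  set s := φ.range.filter (· ≠ 0) with hs
  let e := s.equivFin.symm
  have hpos (k : Fin s.card) : ((e k : s) : ℝ≥0∞) ≠ 0 := (Finset.mem_filter.1 (e k).2).2
  let B (k : Fin s.card) : Set Plane := φ ⁻¹' {((e k : s) : ℝ≥0∞)}
  have hBm (k) : MeasurableSet (B k) := φ.measurableSet_preimage _
  have hdis : Pairwise (fun k l => Disjoint (B k) (B l)) := by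
    intro k l hkl
    refine Disjoint.preimage _ (disjoint_singleton.2 fun h => hkl ?_)
    exact e.injective (Subtype.ext h)
  have hind := hX.indep_count _ B hBm hdis
  have hsumFin (g : ℝ≥0∞ → ℝ≥0∞) : ∑ k, g (e k) = ∑ b ∈ s, g b := by
    rw [← Finset.sum_coe_sort s g]
    exact e.sum_comp fun b : s => g b
  have hφ (z : Plane) : φ z = ∑ k, (e k : ℝ≥0∞) * (B k).indicator 1 z := by
    rw [hsumFin fun b => b * (φ ⁻¹' {b}).indicator 1 z]
    by_cases hz : φ z = 0
    · rw [hz, Finset.sum_eq_zero]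
      intro b hb
      have : z ∉ φ ⁻¹' {b} := fun h => (Finset.mem_filter.1 hb).2 (by simpa [hz] using h.symm)
      simp [this]
    · rw [Finset.sum_eq_single (φ z)]
      · simp
      · intro b _ hb
        have : z ∉ φ ⁻¹' {b} := fun h => hb h.symm
        simp [this]
      · intro h
        exact absurd (Finset.mem_filter.2 ⟨φ.mem_range_self z, hz⟩) h
  have hsum (ω : Ω) : ∑' i, φ (X i ω) = ∑ k, (e k : ℝ≥0∞) * pointCount X (B k) ω := by
    simp_rw [hφ, pointCount, ← ENNReal.tsum_mul_left]
    exact Summable.tsum_finsetSum fun _ _ => ENNReal.summable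
  simp_rw [hsum, negExp_sum]
  have hm (k : Fin s.card) : Measurable fun x : ℝ≥0∞ => negExp ((e k : ℝ≥0∞) * x) :=
    measurable_negExp.comp (measurable_const_mul _)
  rw [lintegral_prod_eq_prod_lintegral_of_indepFun Finset.univ
    (fun k ω => negExp ((e k : ℝ≥0∞) * pointCount X (B k) ω))
    (hind.comp (fun k x => negExp ((e k : ℝ≥0∞) * x)) hm)
    (fun k => (hm k).comp (hX.measurable_pointCount (hBm k)))]
  rw [Finset.prod_congr rfl fun k _ =>
    hX.lintegral_negExp_pointCount (hBm k) (hfin _ (hpos k)) _, ← negExp_sum, ← Finset.mul_sum,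
    hsumFin fun b => (1 - negExp b) * volume (φ ⁻¹' {b})]
  congr 2
  have := SimpleFunc.map_lintegral (μ := (volume : Measure Plane)) (fun b => 1 - negExp b) φ
  rw [← SimpleFunc.lintegral_eq_lintegral] at this
  simp only [SimpleFunc.coe_map, Function.comp] at this
  rw [this, hs, Finset.sum_filter_of_ne]
  rintro b - hb rfl
  simp at hb

/-- The Laplace functional of a Poisson process. -/
lemma laplace [IsProbabilityMeasure P] (hX : IsPoissonProcess P X lam) {φ : Plane → ℝ≥0∞}
    (hφ : Measurable φ) (hfin : ∫⁻ z, φ z ≠ ∞) :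
    ∫⁻ ω, negExp (∑' i, φ (X i ω)) ∂P = negExp (lam * ∫⁻ z, (1 - negExp (φ z))) := by
  have hmono (z : Plane) : Monotone fun n => SimpleFunc.eapprox φ n z :=
    fun m n h => SimpleFunc.monotone_eapprox φ h z
  have hlim (z : Plane) : Tendsto (fun n => SimpleFunc.eapprox φ n z) atTop (𝓝 (φ z)) :=
    SimpleFunc.tendsto_eapprox hφ z
  have hle (n : ℕ) (z : Plane) : SimpleFunc.eapprox φ n z ≤ φ z := (hmono z).ge_of_tendsto (hlim z) n
  have hfin' (n : ℕ) (b : ℝ≥0∞) (hb : b ≠ 0) :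
      volume (SimpleFunc.eapprox φ n ⁻¹' {b}) ≠ ∞ := by
    -- Markov's inequality: integrability of `φ` makes the nonzero level sets of its approximations
    -- finite in area.
    have h1 : b * volume {z | b ≤ φ z} ≤ ∫⁻ z, φ z := mul_meas_ge_le_lintegral hφ b
    have h2 : volume {z | b ≤ φ z} ≠ ∞ := fun h => by
      rw [h, ENNReal.mul_top hb] at h1
      exact hfin (top_le_iff.1 h1)
    refine ne_top_of_le_ne_top h2 (measure_mono fun z hz => ?_)
    have : SimpleFunc.eapprox φ n z = b := hz
    exact this ▸ hle n z
  have h1 : Tendsto (fun n => ∫⁻ ω, negExp (∑' i, SimpleFunc.eapprox φ n (X i ω)) ∂P) atTop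
      (𝓝 (∫⁻ ω, negExp (∑' i, φ (X i ω)) ∂P)) := by
    refine tendsto_lintegral_of_dominated_convergence (fun _ => 1)
      (fun n => measurable_negExp.comp (hX.measurable_tsum (SimpleFunc.eapprox φ n).measurable))
      (fun n => ae_of_all _ fun ω => negExp_le_one _) (by simp) (ae_of_all _ fun ω => ?_)
    exact (continuous_negExp.tendsto _).comp
      (tendsto_tsum_of_monotone (fun i => hmono _) fun i => hlim _)
  have h2 : Tendsto (fun n => negExp (lam * ∫⁻ z, (1 - negExp (SimpleFunc.eapprox φ n z)))) atTop
      (𝓝 (negExp (lam * ∫⁻ z, (1 - negExp (φ z))))) := by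
    refine (continuous_negExp.tendsto _).comp
      (ENNReal.Tendsto.const_mul ?_ (Or.inr ENNReal.coe_ne_top))
    refine lintegral_tendsto_of_tendsto_of_monotone
      (fun n => ((measurable_negExp.comp (SimpleFunc.eapprox φ n).measurable).const_sub
        1).aemeasurable)
      (ae_of_all _ fun z m n h => tsub_le_tsub_left (negExp_antitone (hmono z h)) _)
      (ae_of_all _ fun z => ?_)
    exact ENNReal.Tendsto.sub tendsto_const_nhds ((continuous_negExp.tendsto _).comp (hlim z))
      (Or.inl ENNReal.one_ne_top)
  refine tendsto_nhds_unique h1 (h2.congr fun n => ?_)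
  exact (hX.laplace_simpleFunc _ (hfin' n)).symm

end IsPoissonProcess

end PoissonProcess

/-! ### The Mecke formula by differentiating the Laplace functional. -/

section Mecke

open Filter Topology

/-- A right derivative at `0` written as a sequence of difference quotients with step `1 / (k + 1)`,
the form needed for dominated convergence in `[0, ∞]`. -/
lemma tendsto_mul_ofReal_of_hasDerivAt {f : ℝ → ℝ} {c : ℝ} (hf : HasDerivAt f c 0)
    (h0 : f 0 = 0) :
    Tendsto (fun k : ℕ => ((k + 1 : ℕ) : ℝ≥0∞) * ENNReal.ofReal (f (1 / ((k : ℝ) + 1)))) atTop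
      (𝓝 (ENNReal.ofReal c)) := by
  have h1 : Tendsto (fun k : ℕ => 1 / ((k : ℝ) + 1)) atTop (𝓝[≠] 0) :=
    tendsto_nhdsWithin_iff.2 ⟨tendsto_one_div_add_atTop_nhds_zero_nat, Eventually.of_forall
      fun k => (by positivity : (1 / ((k : ℝ) + 1)) ≠ 0)⟩
  have h2 := (hasDerivAt_iff_tendsto_slope_zero.1 hf).comp h1
  refine ((ENNReal.continuous_ofReal.tendsto c).comp h2).congr fun k => ?_
  have : (0 : ℝ) ≤ (k : ℝ) + 1 := by positivity
  simp only [Function.comp, zero_add, h0, sub_zero, smul_eq_mul, one_div, inv_inv]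
  rw [ENNReal.ofReal_mul this, ← ENNReal.ofReal_natCast (k + 1)]
  push_cast
  rfl

lemma tendsto_mul_one_sub_negExp {c : ℝ≥0∞} (hc : c ≠ ∞) :
    Tendsto (fun k : ℕ => ((k + 1 : ℕ) : ℝ≥0∞) * (1 - negExp (((k + 1 : ℕ) : ℝ≥0∞)⁻¹ * c))) atTop
      (𝓝 c) := by
  have hd : HasDerivAt (fun t : ℝ => 1 - Real.exp (-(t * c.toReal))) c.toReal 0 := by
    have := (((hasDerivAt_id (0 : ℝ)).mul_const c.toReal).neg.exp).const_sub 1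
    simpa using this
  have := tendsto_mul_ofReal_of_hasDerivAt hd (by simp)
  rw [ENNReal.ofReal_toReal hc] at this
  refine this.congr fun k => ?_
  congr 1
  have hk : (0 : ℝ) < (k : ℝ) + 1 := by positivity
  rw [ENNReal.ofReal_sub _ (Real.exp_pos _).le, ENNReal.ofReal_one,
    ← negExp_ofReal (by positivity), ENNReal.ofReal_mul (by positivity), ENNReal.ofReal_toReal hc,
    one_div, ENNReal.ofReal_inv_of_pos hk, ← ENNReal.ofReal_natCast (k + 1)]
  push_cast
  rfl

lemma tendsto_mul_one_sub_negExp_mul_one_sub_negExp {c : ℝ≥0∞} (hc : c ≠ ∞) :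
    Tendsto (fun k : ℕ => ((k + 1 : ℕ) : ℝ≥0∞) *
      (1 - negExp (c * (1 - negExp ((k + 1 : ℕ) : ℝ≥0∞)⁻¹)))) atTop (𝓝 c) := by
  have hd : HasDerivAt (fun t : ℝ => 1 - Real.exp (-(c.toReal * (1 - Real.exp (-t))))) c.toReal
      0 := by
    have := ((((hasDerivAt_id (0 : ℝ)).neg.exp).const_sub 1).const_mul c.toReal).neg.exp.const_sub 1
    simpa using this
  have := tendsto_mul_ofReal_of_hasDerivAt hd (by simp)
  rw [ENNReal.ofReal_toReal hc] at this
  refine this.congr fun k => ?_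
  congr 1
  have hk : (0 : ℝ) < (k : ℝ) + 1 := by positivity
  have h1 : 0 ≤ 1 - Real.exp (-(1 / ((k : ℝ) + 1))) := by
    have : Real.exp (-(1 / ((k : ℝ) + 1))) ≤ 1 := Real.exp_le_one_iff.2 (by
      rw [neg_nonpos]; positivity)
    linarith
  rw [ENNReal.ofReal_sub _ (Real.exp_pos _).le, ENNReal.ofReal_one,
    ← negExp_ofReal (by positivity), ENNReal.ofReal_mul (by positivity), ENNReal.ofReal_toReal hc,
    ENNReal.ofReal_sub _ (Real.exp_pos _).le, ENNReal.ofReal_one,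
    ← negExp_ofReal (by positivity),
    one_div, ENNReal.ofReal_inv_of_pos hk, ← ENNReal.ofReal_natCast (k + 1)]
  push_cast
  rfl

lemma tsum_eq_add_tsum_ne (f : ℕ → ℝ≥0∞) (i : ℕ) :
    ∑' j, f j = f i + ∑' j : {j // j ≠ i}, f j := by
  rw [ENNReal.tsum_eq_add_tsum_ite i]
  congr 1
  refine Eq.trans ?_ (tsum_subtype {j | j ≠ i} f).symm
  congr 1; ext j
  by_cases h : j = i <;> simp [h]

variable {Ω : Type*} [MeasurableSpace Ω] {P : Measure Ω} {X : ℕ → Ω → Plane} {lam : ℝ≥0}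

namespace IsPoissonProcess

variable [IsProbabilityMeasure P]

/-- The Laplace functional of `φ + t * 1_C` is differentiated at `t = 0`. On the left, the
difference quotients are dominated by the count in `C`, which is integrable. -/
lemma lintegral_pointCount_mul_negExp (hX : IsPoissonProcess P X lam) {φ : Plane → ℝ≥0∞}
    (hφ : Measurable φ) (hfin : ∫⁻ z, φ z ≠ ∞) {C : Set Plane} (hC : MeasurableSet C)
    (hCfin : volume C ≠ ∞) :
    ∫⁻ ω, pointCount X C ω * negExp (∑' j, φ (X j ω)) ∂P =
      negExp (lam * ∫⁻ z, (1 - negExp (φ z))) * (lam * ∫⁻ z in C, negExp (φ z)) := by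
  set S : Ω → ℝ≥0∞ := fun ω => ∑' j, φ (X j ω) with hS
  set I : ℝ≥0∞ := ∫⁻ z in C, negExp (φ z) with hI
  set J : ℝ≥0∞ := ∫⁻ z, (1 - negExp (φ z)) with hJ
  have hSm : Measurable S := hX.measurable_tsum hφ
  have hNm : Measurable (pointCount X C) := hX.measurable_pointCount hC
  have hIfin : I ≠ ∞ := by
    refine ne_top_of_le_ne_top hCfin ?_
    calc I ≤ ∫⁻ _ in C, 1 := lintegral_mono fun z => negExp_le_one _
      _ = volume C := by simp
  have hlap (t : ℝ≥0∞) (ht : t ≠ ∞) : ∫⁻ ω, negExp (S ω + t * pointCount X C ω) ∂P =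
      negExp (lam * J) * negExp (lam * I * (1 - negExp t)) := by
    have hCm : Measurable (C.indicator (1 : Plane → ℝ≥0∞)) := measurable_one.indicator hC
    have h1 (ω : Ω) : S ω + t * pointCount X C ω =
        ∑' j, (φ (X j ω) + t * C.indicator 1 (X j ω)) := by
      rw [ENNReal.tsum_add, ENNReal.tsum_mul_left]; rfl
    simp_rw [h1]
    rw [hX.laplace (φ := fun z => φ z + t * C.indicator 1 z) (hφ.add (hCm.const_mul t)),
      ← negExp_add]
    -- This splitting makes the dependence on `t` explicit: the exponent is `lam * J + lam * I * (1
    -- - e ^ (-t))`, with derivative `lam * I` at `0`.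
    · have h2 (z : Plane) : 1 - negExp (φ z + t * C.indicator 1 z) =
          (1 - negExp (φ z)) + (1 - negExp t) * C.indicator (fun z => negExp (φ z)) z := by
        by_cases hz : z ∈ C
        · simp only [hz, indicator_of_mem, Pi.one_apply, mul_one, negExp_add]
          rw [ENNReal.sub_mul (fun _ _ => negExp_ne_top _), one_mul, mul_comm (negExp t),
            tsub_add_tsub_cancel (negExp_le_one _) (mul_le_of_le_one_right' (negExp_le_one _))]
        · simp [hz]
      simp_rw [h2]
      have hφm : Measurable fun z => negExp (φ z) := measurable_negExp.comp hφ
      rw [lintegral_add_left (hφm.const_sub 1), lintegral_const_mul _ (hφm.indicator hC),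
        lintegral_indicator hC]
      congr 1
      ring
    · rw [lintegral_add_left hφ, lintegral_const_mul _ hCm, lintegral_indicator_one hC]
      exact ENNReal.add_ne_top.2 ⟨hfin, ENNReal.mul_ne_top ht hCfin⟩
  have hlap0 : ∫⁻ ω, negExp (S ω) ∂P = negExp (lam * J) := by
    simpa using hlap 0 (by simp)
  have hkey (k : ℕ) : ∫⁻ ω, ((k + 1 : ℕ) : ℝ≥0∞) *
      (1 - negExp (((k + 1 : ℕ) : ℝ≥0∞)⁻¹ * pointCount X C ω)) * negExp (S ω) ∂P =
      negExp (lam * J) * (((k + 1 : ℕ) : ℝ≥0∞) *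
        (1 - negExp (lam * I * (1 - negExp ((k + 1 : ℕ) : ℝ≥0∞)⁻¹)))) := by
    have ht : ((k + 1 : ℕ) : ℝ≥0∞)⁻¹ ≠ ∞ := by simp
    have h3 (ω : Ω) : ((k + 1 : ℕ) : ℝ≥0∞) *
        (1 - negExp (((k + 1 : ℕ) : ℝ≥0∞)⁻¹ * pointCount X C ω)) * negExp (S ω) =
        ((k + 1 : ℕ) : ℝ≥0∞) * (negExp (S ω) -
          negExp (S ω + ((k + 1 : ℕ) : ℝ≥0∞)⁻¹ * pointCount X C ω)) := by
      rw [negExp_add, mul_assoc, ENNReal.sub_mul (fun _ _ => negExp_ne_top _), one_mul,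
        mul_comm (negExp (S ω))]
    simp_rw [h3]
    have hm1 : Measurable fun ω =>
        negExp (S ω + ((k + 1 : ℕ) : ℝ≥0∞)⁻¹ * pointCount X C ω) :=
      measurable_negExp.comp (hSm.add (hNm.const_mul _))
    rw [lintegral_const_mul' _ _ (by simp), lintegral_sub hm1 _
      (ae_of_all _ fun ω => negExp_antitone le_self_add), hlap0, hlap _ ht]
    · rw [mul_left_comm, ENNReal.mul_sub (fun _ _ => negExp_ne_top _), mul_one]
    · rw [hlap _ ht]
      exact ENNReal.mul_ne_top (negExp_ne_top _) (negExp_ne_top _)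
  have hlamI : lam * I ≠ ∞ := ENNReal.mul_ne_top ENNReal.coe_ne_top hIfin
  have hR := ENNReal.Tendsto.const_mul (tendsto_mul_one_sub_negExp_mul_one_sub_negExp hlamI)
    (Or.inr (negExp_ne_top (lam * J)))
  have hEN : ∫⁻ ω, pointCount X C ω ∂P ≠ ∞ := by
    rw [hX.lintegral_pointCount hC hCfin]
    exact ENNReal.mul_ne_top ENNReal.coe_ne_top hCfin
  have hL : Tendsto (fun k : ℕ => ∫⁻ ω, ((k + 1 : ℕ) : ℝ≥0∞) *
      (1 - negExp (((k + 1 : ℕ) : ℝ≥0∞)⁻¹ * pointCount X C ω)) * negExp (S ω) ∂P) atTop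
      (𝓝 (∫⁻ ω, pointCount X C ω * negExp (S ω) ∂P)) := by
    refine tendsto_lintegral_of_dominated_convergence (pointCount X C) (fun k => ?_)
      (fun k => ae_of_all _ fun ω => ?_) hEN ?_
    · exact (((measurable_negExp.comp (hNm.const_mul _)).const_sub 1).const_mul _).mul
        (measurable_negExp.comp hSm)
    · refine (mul_le_of_le_one_right' (negExp_le_one _)).trans ?_
      refine (mul_le_mul_right (one_sub_negExp_le _) _).trans ?_
      rw [← mul_assoc, ENNReal.mul_inv_cancel (by simp) (by simp), one_mul]
    · filter_upwards [ae_lt_top hNm hEN] with ω hω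
      exact ENNReal.Tendsto.mul_const (tendsto_mul_one_sub_negExp hω.ne)
        (Or.inr (negExp_ne_top _))
  exact tendsto_nhds_unique hL (hR.congr fun k => (hkey k).symm)

/-- Each side integrates `u` against a measure on the plane: the intensity under the weight `e ^ (-∑
φ)`, and a multiple of Lebesgue measure with density `e ^ (-φ)`. The case of an indicator identifies
the two measures. -/
lemma lintegral_tsum_mul_negExp (hX : IsPoissonProcess P X lam) {φ : Plane → ℝ≥0∞}
    (hφ : Measurable φ) (hfin : ∫⁻ z, φ z ≠ ∞) {u : Plane → ℝ≥0∞} (hu : Measurable u) :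
    ∫⁻ ω, ∑' i, u (X i ω) * negExp (∑' j, φ (X j ω)) ∂P =
      negExp (lam * ∫⁻ z, (1 - negExp (φ z))) * (lam * ∫⁻ z, u z * negExp (φ z)) := by
  set Λ := negExp (lam * ∫⁻ z, (1 - negExp (φ z)))
  have hSm : Measurable fun ω => negExp (∑' j, φ (X j ω)) :=
    measurable_negExp.comp (hX.measurable_tsum hφ)
  have hφm : Measurable fun z => negExp (φ z) := measurable_negExp.comp hφ
  have hm {v : Plane → ℝ≥0∞} (hv : Measurable v) (i : ℕ) : AEMeasurable
      (fun ω => v (X i ω) * negExp (∑' j, φ (X j ω))) P :=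
    ((hX.measurable_comp hv i).mul hSm).aemeasurable
  have hmap {v : Plane → ℝ≥0∞} (hv : Measurable v) (i : ℕ) :
      ∫⁻ z, v z ∂((P.withDensity fun ω => negExp (∑' j, φ (X j ω))).map (X i)) =
      ∫⁻ ω, v (X i ω) * negExp (∑' j, φ (X j ω)) ∂P := by
    rw [lintegral_map hv (hX.measurable_point i),
      lintegral_withDensity_eq_lintegral_mul _ hSm (hX.measurable_comp hv i)]
    simp only [Pi.mul_apply, mul_comm]
  have key : Measure.sum
      (fun i => (P.withDensity fun ω => negExp (∑' j, φ (X j ω))).map (X i)) =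
      (Λ * lam) • (volume : Measure Plane).withDensity fun z => negExp (φ z) := by
    refine ext_of_finite_volume fun s hs hsfin => ?_
    rw [Measure.sum_apply _ hs, Measure.smul_apply, smul_eq_mul, withDensity_apply _ hs,
      mul_assoc, ← hX.lintegral_pointCount_mul_negExp hφ hfin hs hsfin]
    simp_rw [pointCount, ← ENNReal.tsum_mul_right]
    rw [MeasureTheory.lintegral_tsum fun i => hm (measurable_one.indicator hs) i]
    congr 1; ext i
    rw [← hmap (measurable_one.indicator hs), lintegral_indicator_one hs]
  rw [MeasureTheory.lintegral_tsum fun i => hm hu i]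
  simp_rw [← hmap hu]
  rw [← lintegral_sum_measure, key, lintegral_smul_measure, smul_eq_mul,
    lintegral_withDensity_eq_lintegral_mul _ hφm hu, mul_assoc]
  simp only [Pi.mul_apply, mul_comm]

/-- The Mecke formula for an exponential functional of the other points. -/
lemma mecke_negExp (hX : IsPoissonProcess P X lam) {φ : Plane → ℝ≥0∞}
    (hφ : Measurable φ) (hfin : ∫⁻ z, φ z ≠ ∞) (htop : ∀ z, φ z ≠ ∞) {C : Set Plane}
    (hC : MeasurableSet C) :
    ∫⁻ ω, ∑' i, C.indicator 1 (X i ω) * negExp (∑' j : {j // j ≠ i}, φ (X j ω)) ∂P =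
      lam * volume C * negExp (lam * ∫⁻ z, (1 - negExp (φ z))) := by
  have hcancel (z : Plane) : (negExp (φ z))⁻¹ * negExp (φ z) = 1 :=
    ENNReal.inv_mul_cancel (by simpa [negExp_eq_zero_iff] using htop z) (negExp_ne_top _)
  -- The point's own factor `e ^ (-φ (X i))` is divided out, which is possible because `φ` is finite
  -- everywhere.
  have h1 (ω : Ω) (i : ℕ) : (C.indicator 1 (X i ω) : ℝ≥0∞) *
      negExp (∑' j : {j // j ≠ i}, φ (X j ω)) =
      C.indicator 1 (X i ω) * (negExp (φ (X i ω)))⁻¹ * negExp (∑' j, φ (X j ω)) := by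
    have : ∑' j, φ (X j ω) = φ (X i ω) + ∑' j : {j // j ≠ i}, φ (X j ω) := by
      exact tsum_eq_add_tsum_ne _ i
    rw [this, negExp_add, mul_assoc, ← mul_assoc _ (negExp (φ (X i ω))), hcancel, one_mul]
  simp_rw [h1]
  rw [hX.lintegral_tsum_mul_negExp hφ hfin
    (u := fun z => C.indicator 1 z * (negExp (φ z))⁻¹)
    ((measurable_one.indicator hC).mul (measurable_negExp.comp hφ).inv)]
  simp_rw [mul_assoc, hcancel, mul_one]
  rw [lintegral_indicator_one hC]
  ring

end IsPoissonProcess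

end Mecke

/-! ### Exponential functionals of the process seen from its own points. -/

section Campbell

open Filter Topology

variable {Ω : Type*} [MeasurableSpace Ω] {P : Measure Ω} {X : ℕ → Ω → Plane} {lam : ℝ≥0}

/-- The Campbell measure of the points in `B`, as a measure on pairs of an outcome and the index
of a point in `B`. -/
noncomputable def campbellMeasure (P : Measure Ω) (X : ℕ → Ω → Plane) (B : Set Plane) :
    Measure (Ω × ℕ) :=
  (P.prod Measure.count).restrict {p | X p.2 p.1 ∈ B}

lemma measurable_uncurry_nat {α β : Type*} [MeasurableSpace α] [MeasurableSpace β]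
    {f : α × ℕ → β} (hf : ∀ i, Measurable fun a => f (a, i)) : Measurable f :=
  measurable_from_prod_countable_left hf

lemma measurable_negExp_tsum_ne {g : ℕ → ℕ → Ω → ℝ≥0∞} (hg : ∀ i j, Measurable (g i j)) :
    Measurable fun p : Ω × ℕ => negExp (∑' j : {j // j ≠ p.2}, g p.2 j p.1) :=
  measurable_uncurry_nat fun i => by
    have h : Measurable fun ω => ∑' j : {j // j ≠ i}, g i j ω := Measurable.tsum fun j => hg i j
    exact measurable_negExp.comp h

namespace IsPoissonProcess

lemma measurableSet_mem (hX : IsPoissonProcess P X lam) {B : Set Plane} (hB : MeasurableSet B) :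
    MeasurableSet {p : Ω × ℕ | X p.2 p.1 ∈ B} :=
  (measurable_uncurry_nat (f := fun p : Ω × ℕ => X p.2 p.1) hX.measurable_point) hB

lemma lintegral_campbellMeasure [SFinite P] (hX : IsPoissonProcess P X lam) {B : Set Plane}
    (hB : MeasurableSet B) {f : Ω × ℕ → ℝ≥0∞} (hf : Measurable f) :
    ∫⁻ p, f p ∂campbellMeasure P X B =
      ∫⁻ ω, ∑' i, B.indicator 1 (X i ω) * f (ω, i) ∂P := by
  rw [campbellMeasure, ← lintegral_indicator (hX.measurableSet_mem hB),
    lintegral_prod _ (hf.indicator (hX.measurableSet_mem hB)).aemeasurable]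
  simp_rw [lintegral_count]
  congr 1; ext ω; congr 1; ext i
  by_cases h : X i ω ∈ B <;> simp [indicator, h]

lemma campbellMeasure_univ [SFinite P] (hX : IsPoissonProcess P X lam) {B : Set Plane}
    (hB : MeasurableSet B) : campbellMeasure P X B univ = lam * volume B := by
  rw [← lintegral_one, hX.lintegral_campbellMeasure hB measurable_const]
  simp only [mul_one]
  rw [hX.lintegral_tsum (measurable_one.indicator hB), lintegral_indicator_one hB]

/-- On each piece of `B` where `r` is a constant `v`, the Mecke formula applies to the translate `φ
(· - v)`. By translation invariance its exponent does not depend on `v`, and the areas of the pieces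
add up to that of `B`. -/
lemma lintegral_campbellMeasure_negExp_simpleFunc [IsProbabilityMeasure P]
    (hX : IsPoissonProcess P X lam) {φ : Plane → ℝ≥0∞} (hφ : Measurable φ)
    (hfin : ∫⁻ z, φ z ≠ ∞) (htop : ∀ z, φ z ≠ ∞) {B : Set Plane} (hB : MeasurableSet B)
    (r : SimpleFunc Plane Plane) :
    ∫⁻ p, negExp (∑' j : {j // j ≠ p.2}, φ (X j p.1 - r (X p.2 p.1)))
      ∂campbellMeasure P X B = lam * volume B * negExp (lam * ∫⁻ z, (1 - negExp (φ z))) := by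
  have hshift (v : Plane) : Measurable fun z => φ (z - v) := hφ.comp (measurable_id.sub_const v)
  have hsum (v : Plane) (i : ℕ) :
      Measurable fun ω => negExp (∑' j : {j // j ≠ i}, φ (X j ω - v)) :=
    measurable_negExp.comp (Measurable.tsum fun j => hX.measurable_comp (hshift v) j)
  have hm : Measurable fun p : Ω × ℕ =>
      negExp (∑' j : {j // j ≠ p.2}, φ (X j p.1 - r (X p.2 p.1))) := by
    refine measurable_negExp_tsum_ne (g := fun i j ω => φ (X j ω - r (X i ω))) fun i j => ?_
    exact hφ.comp ((hX.measurable_point j).sub (r.measurable.comp (hX.measurable_point i)))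
  have hBr (v : Plane) : MeasurableSet (B ∩ r ⁻¹' {v}) := hB.inter (r.measurableSet_preimage _)
  rw [hX.lintegral_campbellMeasure hB hm]
  have h1 (ω : Ω) (i : ℕ) : (B.indicator 1 (X i ω) : ℝ≥0∞) *
      negExp (∑' j : {j // j ≠ i}, φ (X j ω - r (X i ω))) =
      ∑ v ∈ r.range, (B ∩ r ⁻¹' {v}).indicator 1 (X i ω) *
        negExp (∑' j : {j // j ≠ i}, φ (X j ω - v)) := by
    rw [Finset.sum_eq_single (r (X i ω))]
    · by_cases h : X i ω ∈ B <;> simp [h]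
    · intro v _ hv
      have : X i ω ∉ B ∩ r ⁻¹' {v} := fun h => hv h.2.symm
      simp [this]
    · exact fun h => absurd (r.mem_range_self _) h
  simp_rw [h1]
  have h2 (ω : Ω) : ∑' i, ∑ v ∈ r.range, (B ∩ r ⁻¹' {v}).indicator 1 (X i ω) *
        negExp (∑' j : {j // j ≠ i}, φ (X j ω - v)) =
      ∑ v ∈ r.range, ∑' i, (B ∩ r ⁻¹' {v}).indicator 1 (X i ω) *
        negExp (∑' j : {j // j ≠ i}, φ (X j ω - v)) :=
    Summable.tsum_finsetSum fun _ _ => ENNReal.summable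
  simp_rw [h2]
  have hmv (v : Plane) : Measurable fun ω => ∑' i, (B ∩ r ⁻¹' {v}).indicator 1 (X i ω) *
      negExp (∑' j : {j // j ≠ i}, φ (X j ω - v)) :=
    Measurable.tsum fun i =>
      (hX.measurable_comp (measurable_one.indicator (hBr v)) i).mul (hsum v i)
  rw [lintegral_finsetSum _ fun v _ => hmv v]
  have h3 (v : Plane) : ∫⁻ ω, ∑' i, (B ∩ r ⁻¹' {v}).indicator 1 (X i ω) *
        negExp (∑' j : {j // j ≠ i}, φ (X j ω - v)) ∂P =
      volume (B ∩ r ⁻¹' {v}) * (lam * negExp (lam * ∫⁻ z, (1 - negExp (φ z)))) := by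
    rw [hX.mecke_negExp (hshift v) (by rwa [lintegral_sub_right_eq_self φ v])
      (fun z => htop _) (hBr v), lintegral_sub_right_eq_self (fun z => 1 - negExp (φ z)) v]
    ring
  simp_rw [h3]
  rw [← Finset.sum_mul]
  have h4 : ∑ v ∈ r.range, volume (B ∩ r ⁻¹' {v}) = volume B := by
    have := sum_measure_preimage_singleton (μ := (volume : Measure Plane).restrict B) (f := r)
      r.range fun v _ => r.measurableSet_preimage _
    have h5 : r ⁻¹' (r.range : Set Plane) = univ := by
      ext z; simp
    rw [h5, Measure.restrict_apply_univ] at this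
    rw [← this]
    refine Finset.sum_congr rfl fun v _ => ?_
    rw [Measure.restrict_apply (r.measurableSet_preimage _), inter_comm]
  rw [h4]
  ring

/-- The centre `X i` is the limit of simple functions `r n` of it, and continuity of `φ` carries the
identity over. The bound is needed for shifts up to `R + R` because `‖r n x‖` is only known to be at
most `2 * ‖x‖`. -/
lemma lintegral_campbellMeasure_negExp_of_continuous [IsProbabilityMeasure P]
    (hX : IsPoissonProcess P X lam) {φ b : Plane → ℝ≥0∞} (hφ : Continuous φ) (hb : Measurable b)
    (hfin : ∫⁻ z, b z ≠ ∞) (htop : ∀ z, φ z ≠ ∞) {R : ℝ} (hR : 0 ≤ R)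
    (hle : ∀ u, ‖u‖ ≤ R + R → ∀ z, φ (z - u) ≤ b z) {B : Set Plane} (hB : MeasurableSet B)
    (hBR : ∀ x ∈ B, ‖x‖ ≤ R) :
    ∫⁻ p, negExp (∑' j : {j // j ≠ p.2}, φ (X j p.1 - X p.2 p.1)) ∂campbellMeasure P X B =
      lam * volume B * negExp (lam * ∫⁻ z, (1 - negExp (φ z))) := by
  have hφfin : ∫⁻ z, φ z ≠ ∞ := by
    refine ne_top_of_le_ne_top hfin (lintegral_mono fun z => ?_)
    simpa using hle 0 (by simpa using add_nonneg hR hR) z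
  have hBfin : volume B ≠ ∞ := by
    refine ((Metric.isBounded_closedBall (x := (0 : Plane)) (r := R)).subset
      fun x hx => ?_).measure_lt_top.ne
    simpa using hBR x hx
  let r : ℕ → SimpleFunc Plane Plane :=
    SimpleFunc.approxOn id measurable_id univ 0 (mem_univ 0)
  have hr (x : Plane) : Tendsto (fun n => r n x) atTop (𝓝 x) :=
    SimpleFunc.tendsto_approxOn measurable_id (mem_univ 0) (by simp)
  have hrle (n : ℕ) (x : Plane) : ‖r n x‖ ≤ ‖x‖ + ‖x‖ :=
    SimpleFunc.norm_approxOn_zero_le measurable_id (mem_univ 0) x n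
  have h1 : Tendsto (fun n => ∫⁻ p, negExp (∑' j : {j // j ≠ p.2}, φ (X j p.1 - r n (X p.2 p.1)))
      ∂campbellMeasure P X B) atTop (𝓝 (∫⁻ p, negExp
        (∑' j : {j // j ≠ p.2}, φ (X j p.1 - X p.2 p.1)) ∂campbellMeasure P X B)) := by
    refine tendsto_lintegral_of_dominated_convergence (fun _ => 1) (fun n => ?_)
      (fun n => ae_of_all _ fun ω => negExp_le_one _) ?_ ?_
    · refine measurable_negExp_tsum_ne (g := fun i j ω => φ (X j ω - r n (X i ω))) fun i j => ?_
      exact hφ.measurable.comp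
        ((hX.measurable_point j).sub ((r n).measurable.comp (hX.measurable_point i)))
    · rw [lintegral_one, hX.campbellMeasure_univ hB]
      exact ENNReal.mul_ne_top ENNReal.coe_ne_top hBfin
    -- By Campbell's formula the majorant `b` is almost surely summable over the points, so
    -- dominated convergence applies to the sum over `j`.
    · have hsumfin : ∀ᵐ ω ∂P, ∑' j, b (X j ω) < ∞ := by
        refine ae_lt_top (hX.measurable_tsum hb) ?_
        rw [hX.lintegral_tsum hb]
        exact ENNReal.mul_ne_top ENNReal.coe_ne_top hfin
      have hfst : ∀ᵐ p ∂campbellMeasure P X B, ∑' j, b (X j p.1) < ∞ :=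
        ae_restrict_of_ae (Measure.quasiMeasurePreserving_fst.ae hsumfin)
      filter_upwards [hfst, ae_restrict_mem (hX.measurableSet_mem hB)] with p hp hpB
      have hxR : ‖X p.2 p.1‖ ≤ R := hBR _ hpB
      refine (continuous_negExp.tendsto _).comp ?_
      let : MeasurableSpace {j // j ≠ p.2} := ⊤
      simp_rw [← lintegral_count]
      refine tendsto_lintegral_of_dominated_convergence
        (fun j : {j // j ≠ p.2} => b (X j p.1)) (fun n => measurable_from_top)
        (fun n => ae_of_all _ fun j => ?_) ?_ (ae_of_all _ fun j => ?_)
      · exact hle _ ((hrle n _).trans (add_le_add hxR hxR)) _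
      · rw [lintegral_count]
        exact ((ENNReal.tsum_comp_le_tsum_of_injective Subtype.val_injective
          fun j => b (X j p.1)).trans_lt hp).ne
      · exact (hφ.tendsto _).comp (tendsto_const_nhds.sub (hr _))
  refine tendsto_nhds_unique h1 (tendsto_const_nhds.congr fun n => ?_)
  exact (hX.lintegral_campbellMeasure_negExp_simpleFunc hφ.measurable hφfin htop hB (r n)).symm

/-- Monotone limits allow `φ` to take the value `∞`, as it does for a path loss that vanishes at the
receiver. -/
lemma lintegral_campbellMeasure_negExp_of_monotone [IsProbabilityMeasure P]
    (hX : IsPoissonProcess P X lam) {ψ : ℕ → Plane → ℝ≥0∞} {φ : Plane → ℝ≥0∞}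
    (hψ : ∀ n, Measurable (ψ n)) (hmono : ∀ z, Monotone fun n => ψ n z)
    (hlim : ∀ z, Tendsto (fun n => ψ n z) atTop (𝓝 (φ z)))
    {B : Set Plane} (hB : MeasurableSet B) (hBfin : volume B ≠ ∞)
    (h : ∀ n, ∫⁻ p, negExp (∑' j : {j // j ≠ p.2}, ψ n (X j p.1 - X p.2 p.1))
      ∂campbellMeasure P X B = lam * volume B * negExp (lam * ∫⁻ z, (1 - negExp (ψ n z)))) :
    ∫⁻ p, negExp (∑' j : {j // j ≠ p.2}, φ (X j p.1 - X p.2 p.1)) ∂campbellMeasure P X B =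
      lam * volume B * negExp (lam * ∫⁻ z, (1 - negExp (φ z))) := by
  have h1 : Tendsto (fun n => ∫⁻ p, negExp (∑' j : {j // j ≠ p.2}, ψ n (X j p.1 - X p.2 p.1))
      ∂campbellMeasure P X B) atTop (𝓝 (∫⁻ p, negExp
        (∑' j : {j // j ≠ p.2}, φ (X j p.1 - X p.2 p.1)) ∂campbellMeasure P X B)) := by
    refine tendsto_lintegral_of_dominated_convergence (fun _ => 1) (fun n => ?_)
      (fun n => ae_of_all _ fun ω => negExp_le_one _) ?_ (ae_of_all _ fun p => ?_)
    · refine measurable_negExp_tsum_ne (g := fun i j ω => ψ n (X j ω - X i ω)) fun i j => ?_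
      exact (hψ n).comp ((hX.measurable_point j).sub (hX.measurable_point i))
    · rw [lintegral_one, hX.campbellMeasure_univ hB]
      exact ENNReal.mul_ne_top ENNReal.coe_ne_top hBfin
    · exact (continuous_negExp.tendsto _).comp
        (tendsto_tsum_of_monotone (fun j => hmono _) fun j => hlim _)
  refine tendsto_nhds_unique h1 (Tendsto.congr (fun n => (h n).symm) ?_)
  refine ENNReal.Tendsto.const_mul ((continuous_negExp.tendsto _).comp
      (ENNReal.Tendsto.const_mul ?_ (Or.inr ENNReal.coe_ne_top)))
      (Or.inr (ENNReal.mul_ne_top ENNReal.coe_ne_top hBfin))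
  refine lintegral_tendsto_of_tendsto_of_monotone
    (fun n => ((measurable_negExp.comp (hψ n)).const_sub 1).aemeasurable)
    (ae_of_all _ fun z m n h => tsub_le_tsub_left (negExp_antitone (hmono z h)) _)
    (ae_of_all _ fun z => ?_)
  exact ENNReal.Tendsto.sub tendsto_const_nhds ((continuous_negExp.tendsto _).comp (hlim z))
    (Or.inl ENNReal.one_ne_top)

end IsPoissonProcess

end Campbell

/-! ### The constant `K`, the spatial integral and the singular path loss. -/

section PathLoss

open Filter Topology

/-- Bernoulli's inequality for `(1 - t / (1 + t)) ^ n`, followed by `t / (1 + t) ≤ t`. -/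
lemma one_sub_one_div_one_add_pow_le {t : ℝ} (ht : 0 ≤ t) (n : ℕ) :
    1 - 1 / (1 + t) ^ n ≤ n * t := by
  have h1 : (-2 : ℝ) ≤ 1 / (1 + t) - 1 := by
    have : 0 ≤ 1 / (1 + t) := by positivity
    linarith
  have h2 := one_add_mul_le_pow h1 n
  have h3 : -t ≤ 1 / (1 + t) - 1 := by
    rw [div_sub_one (by positivity), le_div_iff₀ (by positivity)]
    nlinarith
  have h4 : (n : ℝ) * -t ≤ n * (1 / (1 + t) - 1) := mul_le_mul_of_nonneg_left h3 n.cast_nonneg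
  rw [add_sub_cancel, one_div_pow] at h2
  linarith

lemma one_sub_one_div_one_add_pow_nonneg {t : ℝ} (ht : 0 ≤ t) (n : ℕ) :
    0 ≤ 1 - 1 / (1 + t) ^ n := by
  have : 1 / (1 + t) ^ n ≤ 1 := by
    rw [div_le_one (by positivity)]
    exact one_le_pow₀ (by linarith)
  linarith

lemma measurable_integrandK (α : ℝ) (n : ℕ) : Measurable (integrandK α n) := by
  unfold integrandK
  fun_prop

/-- Near `0` the integrand is at most `n * t ^ (-2 / α)`, integrable since `α > 2`; beyond `1` it is
at most `t ^ (-2 / α - 1)`. -/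
lemma integrableOn_integrandK {α : ℝ} (hα : 2 < α) (n : ℕ) :
    IntegrableOn (integrandK α n) (Ioi 0) := by
  have h2α : 2 / α < 1 := (div_lt_one (by linarith)).2 hα
  have h2α0 : 0 < 2 / α := by positivity
  rw [← Ioc_union_Ioi_eq_Ioi (zero_le_one (α := ℝ)), integrableOn_union]
  constructor
  · have h1 : IntegrableOn (fun t : ℝ => n * t ^ (-(2 / α))) (Ioc 0 1) := by
      have := (intervalIntegral.intervalIntegrable_rpow' (a := 0) (b := 1)
        (by linarith : -1 < -(2 / α))).const_mul (n : ℝ)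
      rwa [intervalIntegrable_iff_integrableOn_Ioc_of_le zero_le_one] at this
    refine h1.mono' (measurable_integrandK α n).aestronglyMeasurable ?_
    filter_upwards [ae_restrict_mem measurableSet_Ioc] with t ht
    have h0 := one_sub_one_div_one_add_pow_nonneg ht.1.le n
    rw [integrandK, Real.norm_of_nonneg (mul_nonneg (Real.rpow_nonneg ht.1.le _) h0),
      Real.rpow_sub ht.1, Real.rpow_one]
    calc t ^ (-(2 / α)) / t * (1 - 1 / (1 + t) ^ n) ≤ t ^ (-(2 / α)) / t * (n * t) :=
          mul_le_mul_of_nonneg_left (one_sub_one_div_one_add_pow_le ht.1.le n)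
            (div_nonneg (Real.rpow_nonneg ht.1.le _) ht.1.le)
      _ = n * t ^ (-(2 / α)) := by
          have := ht.1.ne'
          field_simp
  · refine (integrableOn_Ioi_rpow_of_lt (by linarith : -(2 / α) - 1 < -1) zero_lt_one).mono'
      (measurable_integrandK α n).aestronglyMeasurable ?_
    filter_upwards [ae_restrict_mem measurableSet_Ioi] with t ht
    have ht0 : 0 < t := zero_lt_one.trans ht
    have h0 := one_sub_one_div_one_add_pow_nonneg ht0.le n
    rw [integrandK, Real.norm_of_nonneg (mul_nonneg (Real.rpow_nonneg ht0.le _) h0)]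
    refine mul_le_of_le_one_right (Real.rpow_nonneg ht0.le _) ?_
    have : 0 ≤ 1 / (1 + t) ^ n := by positivity
    linarith

/-- The exponent of the Laplace transform of the fading interference over `n` transmissions that
is caused by a transmitter at `z` at a receiver at `y`, with the path loss increased by `A * δ`. -/
noncomputable def interferenceExponent (A α θ δ : ℝ) (n : ℕ) (y z : Plane) : ℝ≥0∞ :=
  n * posLog (1 + ENNReal.ofReal θ / ENNReal.ofReal (A * (‖z - y‖ ^ α + δ)))

variable {A α θ : ℝ}

lemma negExp_interferenceExponent (δ : ℝ) (n : ℕ) (y z : Plane) :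
    negExp (interferenceExponent A α θ δ n y z) =
      ((1 + ENNReal.ofReal θ / ENNReal.ofReal (A * (‖z - y‖ ^ α + δ)))⁻¹) ^ n := by
  rw [interferenceExponent, negExp_nat_mul, negExp_posLog le_self_add]

lemma measurable_interferenceExponent (δ : ℝ) (n : ℕ) (y : Plane) :
    Measurable (interferenceExponent A α θ δ n y) := by
  have h := continuous_posLog.measurable
  unfold interferenceExponent
  fun_prop

lemma one_sub_negExp_interferenceExponent (hA : 0 < A) (hθ : 0 < θ) (n : ℕ) (y z : Plane)
    (hz : z ≠ y) :
    1 - negExp (interferenceExponent A α θ 0 n y z) =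
      ENNReal.ofReal (1 - 1 / (1 + θ / A * ‖z - y‖ ^ (-α)) ^ n) := by
  have hr : 0 < ‖z - y‖ := norm_pos_iff.2 (sub_ne_zero.2 hz)
  have hl : 0 < A * (‖z - y‖ ^ α + 0) := by
    have := Real.rpow_pos_of_pos hr α
    positivity
  have h1 : θ / A * ‖z - y‖ ^ (-α) = θ / (A * (‖z - y‖ ^ α + 0)) := by
    rw [Real.rpow_neg hr.le, add_zero]
    field_simp
  have h2 : 0 < θ / (A * (‖z - y‖ ^ α + 0)) := by positivity
  rw [negExp_interferenceExponent, h1, ← ENNReal.ofReal_div_of_pos hl, ← ENNReal.ofReal_one,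
    ← ENNReal.ofReal_add zero_le_one h2.le, ← ENNReal.ofReal_inv_of_pos (by positivity),
    ← ENNReal.ofReal_pow (by positivity), ← ENNReal.ofReal_sub _ (by positivity), inv_pow, one_div]

/-- The substitution `t = c * r ^ (-α)`: with the Jacobian, the powers of `r` combine to `r ^ 1`,
the radial density of the plane. -/
lemma rpow_mul_integrandK {c r : ℝ} (hα : 2 < α) (hc : 0 < c) (n : ℕ) (hr : 0 < r) :
    (|-α| * r ^ (-α - 1)) • integrandK α n (c * r ^ (-α)) =
      α * c ^ (-(2 / α) - 1) * (r * (1 - 1 / (1 + c * r ^ (-α)) ^ n)) := by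
  have hα0 : α ≠ 0 := by linarith
  rw [integrandK, Real.mul_rpow hc.le (Real.rpow_nonneg hr.le _), ← Real.rpow_mul hr.le, abs_neg,
    abs_of_pos (by linarith : 0 < α), smul_eq_mul]
  have : r ^ (-α - 1) * r ^ (-α * (-(2 / α) - 1)) = r := by
    rw [← Real.rpow_add hr]
    have : -α - 1 + -α * (-(2 / α) - 1) = 1 := by field_simp; ring
    rw [this, Real.rpow_one]
  linear_combination (α * c ^ (-(2 / α) - 1) * (1 - 1 / (1 + c * r ^ (-α)) ^ n)) * this

/-- Polar coordinates contribute the factor `2π`, and the substitution `t = c * r ^ (-α)` reduces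
the radial integral to that of `integrandK`. -/
lemma integral_and_integrable_radial {c : ℝ} (hα : 2 < α) (hc : 0 < c) (n : ℕ) :
    Integrable (fun z : Plane => 1 - 1 / (1 + c * ‖z‖ ^ (-α)) ^ n) ∧
    ∫ z : Plane, (1 - 1 / (1 + c * ‖z‖ ^ (-α)) ^ n) = constK α n * c ^ (2 / α) := by
  have hα0 : -α ≠ 0 := by linarith
  have hK : 0 < α * c ^ (-(2 / α) - 1) := by
    have := Real.rpow_pos_of_pos hc (-(2 / α) - 1)
    have : 0 < α := by linarith
    positivity
  have hdim : Module.finrank ℝ Plane = 2 := by simp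
  have hI : IntegrableOn (fun r : ℝ => (|-α| * r ^ (-α - 1)) • integrandK α n (c * r ^ (-α)))
      (Ioi 0) := by
    rw [integrableOn_Ioi_comp_rpow_iff (fun t => integrandK α n (c * t)) hα0,
      integrableOn_Ioi_comp_mul_left_iff (integrandK α n) 0 hc, mul_zero]
    exact integrableOn_integrandK hα n
  have hE : ∫ r in Ioi (0 : ℝ), (|-α| * r ^ (-α - 1)) • integrandK α n (c * r ^ (-α)) =
      c⁻¹ * ∫ t in Ioi (0 : ℝ), integrandK α n t := by
    rw [integral_comp_rpow_Ioi (fun t => integrandK α n (c * t)) hα0,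
      integral_comp_mul_left_Ioi (integrandK α n) 0 hc, mul_zero, smul_eq_mul]
  have heq : EqOn (fun r : ℝ => (|-α| * r ^ (-α - 1)) • integrandK α n (c * r ^ (-α)))
      (fun r => α * c ^ (-(2 / α) - 1) * (r * (1 - 1 / (1 + c * r ^ (-α)) ^ n))) (Ioi 0) :=
    fun r hr => rpow_mul_integrandK hα hc n hr
  rw [integrableOn_congr_fun heq measurableSet_Ioi] at hI
  rw [setIntegral_congr_fun measurableSet_Ioi heq, integral_const_mul] at hE
  constructor
  · rw [integrable_fun_norm_addHaar (volume : Measure Plane)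
      (f := fun r => 1 - 1 / (1 + c * r ^ (-α)) ^ n), hdim]
    have := hI.const_mul (α * c ^ (-(2 / α) - 1))⁻¹
    refine this.congr (ae_of_all _ fun r => ?_)
    simp only [inv_mul_cancel_left₀ hK.ne', Nat.add_one_sub_one, pow_one, smul_eq_mul]
  · rw [integral_fun_norm_addHaar (volume : Measure Plane)
      (fun r => 1 - 1 / (1 + c * r ^ (-α)) ^ n), hdim]
    have hball : (volume : Measure Plane).real (Metric.ball 0 1) = Real.pi := by
      rw [measureReal_def, EuclideanSpace.volume_ball_fin_two]
      simp [Real.pi_pos.le]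
    rw [hball, constK]
    simp only [Nat.add_one_sub_one, pow_one, smul_eq_mul, nsmul_eq_mul, Nat.cast_ofNat]
    have hc1 : c ^ (2 / α) * (c ^ (-(2 / α) - 1) * c) = 1 := by
      rw [← Real.rpow_add_one hc.ne', ← Real.rpow_add hc]
      simp
    set J := ∫ r in Ioi (0 : ℝ), r * (1 - 1 / (1 + c * r ^ (-α)) ^ n)
    set I := ∫ t in Ioi (0 : ℝ), integrandK α n t
    have hα' : α ≠ 0 := by linarith
    have hI' : I = c * (α * c ^ (-(2 / α) - 1) * J) := by
      rw [hE, mul_inv_cancel_left₀ hc.ne']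
    rw [hI']
    generalize c ^ (-(2 / α) - 1) = q at hc1
    generalize c ^ (2 / α) = u at hc1
    field_simp
    linear_combination (-J) * hc1

lemma lintegral_one_sub_negExp_interferenceExponent (hA : 0 < A) (hα : 2 < α) (hθ : 0 < θ)
    (n : ℕ) (y : Plane) :
    ∫⁻ z, (1 - negExp (interferenceExponent A α θ 0 n y z)) =
      ENNReal.ofReal (constK α n * (θ / A) ^ (2 / α)) := by
  have hc : 0 < θ / A := by positivity
  have h1 : ∫⁻ z, (1 - negExp (interferenceExponent A α θ 0 n y z)) =
      ∫⁻ z : Plane, ENNReal.ofReal (1 - 1 / (1 + θ / A * ‖z - y‖ ^ (-α)) ^ n) := by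
    refine lintegral_congr_ae ?_
    -- At `z = y` the two integrands differ (`1` against `0`, as `0 ^ (-α)` is `0` for real powers),
    -- but a point is a null set.
    filter_upwards [compl_mem_ae_iff.2 (measure_singleton (μ := (volume : Measure Plane)) y)]
      with z hz
    exact one_sub_negExp_interferenceExponent hA hθ n y z hz
  rw [h1, lintegral_sub_right_eq_self
    (fun z : Plane => ENNReal.ofReal (1 - 1 / (1 + θ / A * ‖z‖ ^ (-α)) ^ n)) y,
    ← (integral_and_integrable_radial hα hc n).2,
    ofReal_integral_eq_lintegral_ofReal (integral_and_integrable_radial hα hc n).1]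
  exact ae_of_all _ fun z => one_sub_one_div_one_add_pow_nonneg
    (mul_nonneg hc.le (Real.rpow_nonneg (norm_nonneg z) _)) n

lemma constK_nonneg (hα : 2 < α) (n : ℕ) : 0 ≤ constK α n := by
  have := (integral_and_integrable_radial hα zero_lt_one n).2
  rw [Real.one_rpow, mul_one] at this
  rw [← this]
  exact integral_nonneg fun z => one_sub_one_div_one_add_pow_nonneg
    (mul_nonneg zero_le_one (Real.rpow_nonneg (norm_nonneg z) _)) n

lemma continuous_interferenceExponent (hα : 2 < α) (δ : ℝ) (n : ℕ) (y : Plane) : Continuous (interferenceExponent A α θ δ n y) := by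
  have h1 : Continuous fun z : Plane => ENNReal.ofReal (A * (‖z - y‖ ^ α + δ)) := by
    refine ENNReal.continuous_ofReal.comp (continuous_const.mul (Continuous.add ?_ continuous_const))
    exact (continuous_id.sub continuous_const).norm.rpow_const fun _ => Or.inr (by linarith)
  refine continuous_iff_continuousAt.2 fun z => ?_
  refine ENNReal.Tendsto.const_mul ((continuous_posLog.tendsto _).comp
    (tendsto_const_nhds.add ?_)) (Or.inr (ENNReal.natCast_ne_top n))
  exact ENNReal.Tendsto.const_div (h1.tendsto z) (Or.inr ENNReal.ofReal_ne_top)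

lemma interferenceExponent_le (hA : 0 < A) {δ : ℝ} (hδ : 0 < δ) (n : ℕ)
    (y z : Plane) : interferenceExponent A α θ δ n y z ≤
      ENNReal.ofReal (n * (θ / (A * (‖z - y‖ ^ α + δ)))) := by
  have h : 0 < A * (‖z - y‖ ^ α + δ) := by
    have := Real.rpow_nonneg (norm_nonneg (z - y)) α
    positivity
  rw [ENNReal.ofReal_mul n.cast_nonneg, ENNReal.ofReal_div_of_pos h, ENNReal.ofReal_natCast]
  exact mul_le_mul_right (posLog_one_add_le _) _

lemma one_add_rpow_le {s : ℝ} (hs : 0 ≤ s) (hα : 0 ≤ α) : (1 + s) ^ α ≤ 2 ^ α * (1 + s ^ α) := by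
  have h1 : (1 + s) ^ α ≤ (2 * max 1 s) ^ α := by
    refine Real.rpow_le_rpow (by positivity) ?_ hα
    linarith [le_max_left 1 s, le_max_right 1 s]
  refine h1.trans ?_
  rw [Real.mul_rpow zero_le_two (by positivity)]
  refine mul_le_mul_of_nonneg_left ?_ (by positivity)
  have := Real.rpow_nonneg hs α
  rcases max_choice 1 s with h | h <;> rw [h]
  · simpa using this
  · linarith

/-- An integrable majorant uniform over bounded shifts. It relies on `δ > 0`, since otherwise the
shifts would move the singularity over a whole disc. -/
lemma exists_interferenceExponent_sub_le (hA : 0 < A) (hα : 2 < α) (hθ : 0 < θ) {δ : ℝ}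
    (hδ : 0 < δ) (n : ℕ) (y : Plane) {R : ℝ} (hR : 0 ≤ R) :
    ∃ C : ℝ, ∀ u : Plane, ‖u‖ ≤ R → ∀ z, interferenceExponent A α θ δ n y (z - u) ≤
      ENNReal.ofReal C * ENNReal.ofReal ((1 + ‖z‖) ^ (-α)) := by
  set M := 1 + R + ‖y‖ with hM
  have hM0 : 0 < M := by positivity
  -- With `s = ‖z - u - y‖`: `1 + ‖z‖ ≤ M * (1 + s)`, then `(1 + s) ^ α ≤ 2 ^ α * (1 + s ^ α)`, and
  -- `1 + s ^ α ≤ (1 / δ + 1) * (s ^ α + δ)`.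
  refine ⟨n * (θ / A) * (M ^ α * 2 ^ α * (1 / δ + 1)), fun u hu z => ?_⟩
  refine (interferenceExponent_le hA hδ n y _).trans ?_
  rw [← ENNReal.ofReal_mul (by positivity)]
  refine ENNReal.ofReal_le_ofReal ?_
  set s := ‖z - u - y‖ with hs
  have hs0 : 0 ≤ s := norm_nonneg _
  have hsα : 0 ≤ s ^ α := Real.rpow_nonneg hs0 _
  have hz0 : 0 ≤ ‖z‖ := norm_nonneg _
  have hz : ‖z‖ ≤ s + (R + ‖y‖) := by
    have : z = (z - u - y) + (u + y) := by abel
    calc ‖z‖ = ‖(z - u - y) + (u + y)‖ := by rw [← this]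
      _ ≤ s + ‖u + y‖ := norm_add_le _ _
      _ ≤ s + (R + ‖y‖) := by gcongr; exact (norm_add_le _ _).trans (by gcongr)
  have h1 : 1 + ‖z‖ ≤ M * (1 + s) := by
    have : 0 ≤ (R + ‖y‖) * s := by positivity
    nlinarith
  have h2 : (1 + ‖z‖) ^ α ≤ M ^ α * 2 ^ α * (1 / δ + 1) * (s ^ α + δ) := by
    calc (1 + ‖z‖) ^ α ≤ (M * (1 + s)) ^ α :=
          Real.rpow_le_rpow (by positivity) h1 (by linarith)
      _ = M ^ α * (1 + s) ^ α := Real.mul_rpow hM0.le (by positivity)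
      _ ≤ M ^ α * (2 ^ α * (1 + s ^ α)) := by
          gcongr; exact one_add_rpow_le hs0 (by linarith)
      _ ≤ M ^ α * (2 ^ α * ((1 / δ + 1) * (s ^ α + δ))) := by
          gcongr
          have : (1 / δ + 1) * (s ^ α + δ) = 1 + s ^ α + (s ^ α / δ + δ) := by field_simp; ring
          rw [this]
          have : 0 ≤ s ^ α / δ + δ := by positivity
          linarith
      _ = _ := by ring
  have hzα : 0 < (1 + ‖z‖) ^ α := by positivity
  rw [Real.rpow_neg (by positivity), ← div_eq_mul_inv, le_div_iff₀ hzα]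
  calc n * (θ / (A * (s ^ α + δ))) * (1 + ‖z‖) ^ α
      ≤ n * (θ / (A * (s ^ α + δ))) * (M ^ α * 2 ^ α * (1 / δ + 1) * (s ^ α + δ)) := by gcongr
    _ = n * (θ / A) * (M ^ α * 2 ^ α * (1 / δ + 1)) := by
        have : s ^ α + δ ≠ 0 := by positivity
        field_simp

lemma lintegral_one_add_norm_ne_top (hα : 2 < α) (C : ℝ) :
    ∫⁻ z : Plane, ENNReal.ofReal C * ENNReal.ofReal ((1 + ‖z‖) ^ (-α)) ≠ ∞ := by
  rw [lintegral_const_mul' _ _ ENNReal.ofReal_ne_top]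
  refine ENNReal.mul_ne_top ENNReal.ofReal_ne_top (finite_integral_one_add_norm ?_).ne
  simpa using hα

variable {Ω : Type*} [MeasurableSpace Ω] {P : Measure Ω} {X : ℕ → Ω → Plane} {lam : ℝ≥0}

/-- For `δ = 1 / (k + 1)` the exponent is finite, continuous and dominated; as `k` grows it
increases to the singular one. -/
lemma IsPoissonProcess.lintegral_campbellMeasure_interference [IsProbabilityMeasure P]
    (hX : IsPoissonProcess P X lam) (hA : 0 < A) (hα : 2 < α) (hθ : 0 < θ) (n : ℕ) (y : Plane)
    {B : Set Plane} (hB : MeasurableSet B) (hBbdd : Bornology.IsBounded B) :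
    ∫⁻ p, negExp (∑' j : {j // j ≠ p.2},
      interferenceExponent A α θ 0 n y (X j p.1 - X p.2 p.1)) ∂campbellMeasure P X B =
      lam * volume B *
        negExp (lam * ENNReal.ofReal (constK α n * (θ / A) ^ (2 / α))) := by
  rw [← lintegral_one_sub_negExp_interferenceExponent hA hα hθ n y]
  obtain ⟨R, hBR⟩ := hBbdd.exists_norm_le
  have hδ (k : ℕ) : 0 < 1 / ((k : ℝ) + 1) := by positivity
  have hB' : ∀ x ∈ B, ‖x‖ ≤ |R| := fun x hx => (hBR x hx).trans (le_abs_self R)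
  refine hX.lintegral_campbellMeasure_negExp_of_monotone
    (ψ := fun k => interferenceExponent A α θ (1 / ((k : ℝ) + 1)) n y)
    (fun k => measurable_interferenceExponent _ n y) (fun z k l hkl => ?_) (fun z => ?_) hB
    hBbdd.measure_lt_top.ne fun k => ?_
  · refine mul_le_mul_right (posLog_mono (add_le_add_right
      (ENNReal.div_le_div_left (ENNReal.ofReal_le_ofReal ?_) _) _)) _
    have := Nat.one_div_le_one_div (α := ℝ) hkl
    gcongr
  · refine ENNReal.Tendsto.const_mul ((continuous_posLog.tendsto _).comp
      (tendsto_const_nhds.add ?_)) (Or.inr (ENNReal.natCast_ne_top n))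
    refine ENNReal.Tendsto.const_div ?_ (Or.inr ENNReal.ofReal_ne_top)
    exact (ENNReal.continuous_ofReal.tendsto _).comp
      (tendsto_const_nhds.mul (tendsto_const_nhds.add tendsto_one_div_add_atTop_nhds_zero_nat))
  · obtain ⟨C, hC⟩ := exists_interferenceExponent_sub_le hA hα hθ (hδ k) n y
      (add_nonneg (abs_nonneg R) (abs_nonneg R))
    refine hX.lintegral_campbellMeasure_negExp_of_continuous
      (continuous_interferenceExponent hα _ n y) (by fun_prop)
      (lintegral_one_add_norm_ne_top hα C) (fun z => ?_) (abs_nonneg R) hC hB hB'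
    exact ((interferenceExponent_le hA (hδ k) n y z).trans_lt ENNReal.ofReal_lt_top).ne

end PathLoss

/-! ### Exponential fading with the positions held fixed. -/

section Fading

open Filter Topology

@[simp] lemma posLog_one : posLog 1 = 0 := by simp [posLog]

lemma expMeasure_apply {s : Set ℝ} (hs : MeasurableSet s) :
    expMeasure 1 s = ∫⁻ x in s, exponentialPDF 1 x :=
  withDensity_apply _ hs

lemma measurable_exponentialPDF (r : ℝ) : Measurable (exponentialPDF r) :=
  ENNReal.measurable_ofReal.comp (measurable_exponentialPDFReal r)

lemma lintegral_expMeasure {f : ℝ → ℝ≥0∞} (hf : Measurable f) :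
    ∫⁻ x, f x ∂(expMeasure 1) = ∫⁻ x, exponentialPDF 1 x * f x :=
  lintegral_withDensity_eq_lintegral_mul _ (measurable_exponentialPDF 1) hf

lemma ae_expMeasure_pos : ∀ᵐ x ∂(expMeasure 1), 0 < x := by
  have h : expMeasure 1 (Iic 0) = 0 := by
    rw [expMeasure_apply measurableSet_Iic, lintegral_exponentialPDF_eq_antiDeriv one_pos]
    simp
  filter_upwards [compl_mem_ae_iff.2 h] with x hx
  simpa using hx

lemma expMeasure_tail (a : ℝ≥0∞) : expMeasure 1 {x | a ≤ ENNReal.ofReal x} = negExp a := by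
  have := isProbabilityMeasure_expMeasure one_pos
  by_cases ha : a = ∞
  · simp [ha]
  obtain ⟨x, hx, rfl⟩ : ∃ x : ℝ, 0 ≤ x ∧ ENNReal.ofReal x = a :=
    ⟨a.toReal, ENNReal.toReal_nonneg, ENNReal.ofReal_toReal ha⟩
  have h1 : expMeasure 1 (Iio x) = ENNReal.ofReal (1 - Real.exp (-x)) := by
    rw [expMeasure_apply measurableSet_Iio, setLIntegral_congr Iio_ae_eq_Iic,
      lintegral_exponentialPDF_eq_antiDeriv one_pos, if_pos hx, one_mul]
  -- Truncation of negative `u` to `0` matters only for `x = 0`; almost sure positivity removes the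
  -- discrepancy.
  have h2 : ({u : ℝ | ENNReal.ofReal x ≤ ENNReal.ofReal u} : Set ℝ) =ᵐ[expMeasure 1]
      ((Iio x)ᶜ : Set ℝ) := by
    filter_upwards [ae_expMeasure_pos] with u hu
    refine propext ?_
    change ENNReal.ofReal x ≤ ENNReal.ofReal u ↔ ¬ u < x
    rw [ENNReal.ofReal_le_ofReal_iff hu.le, not_lt]
  rw [measure_congr h2, prob_compl_eq_one_sub measurableSet_Iio, h1, negExp_ofReal hx,
    ← ENNReal.ofReal_one, ← ENNReal.ofReal_sub]
  · congr 1; ring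
  · linarith [Real.exp_le_one_iff.2 (neg_nonpos.2 hx)]

/-- Tilting the `Exp(1)` density by `e ^ (-r x)` gives `(1 + r)⁻¹` times the density of `Exp(1 +
r)`. For `c = ∞` the integrand vanishes where `x > 0`, hence almost surely. -/
lemma lintegral_negExp_expMeasure (c : ℝ≥0∞) :
    ∫⁻ x, negExp (c * ENNReal.ofReal x) ∂(expMeasure 1) = (1 + c)⁻¹ := by
  by_cases hc : c = ∞
  · rw [hc, add_top, ENNReal.inv_top, lintegral_eq_zero_iff]
    · filter_upwards [ae_expMeasure_pos] with x hx
      simp [hx]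
    · exact measurable_negExp.comp (ENNReal.measurable_ofReal.const_mul _)
  obtain ⟨r, hr, rfl⟩ : ∃ x : ℝ, 0 ≤ x ∧ ENNReal.ofReal x = c :=
    ⟨c.toReal, ENNReal.toReal_nonneg, ENNReal.ofReal_toReal hc⟩
  have hr1 : 0 < 1 + r := by linarith
  have hm : Measurable fun x : ℝ => negExp (ENNReal.ofReal r * ENNReal.ofReal x) :=
    measurable_negExp.comp (ENNReal.measurable_ofReal.const_mul _)
  rw [lintegral_expMeasure hm]
  have h (x : ℝ) : exponentialPDF 1 x * negExp (ENNReal.ofReal r * ENNReal.ofReal x) =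
      (1 + ENNReal.ofReal r)⁻¹ * exponentialPDF (1 + r) x := by
    rcases lt_or_ge x 0 with hx | hx
    · simp [exponentialPDF_of_neg hx]
    · rw [exponentialPDF_of_nonneg hx, exponentialPDF_of_nonneg hx, ← ENNReal.ofReal_mul hr,
        negExp_ofReal (mul_nonneg hr hx), ← ENNReal.ofReal_mul (by positivity),
        ← ENNReal.ofReal_one, ← ENNReal.ofReal_add zero_le_one hr,
        ← ENNReal.ofReal_inv_of_pos hr1, ← ENNReal.ofReal_mul (by positivity)]
      congr 1
      rw [inv_mul_cancel_left₀ hr1.ne', one_mul, one_mul, ← Real.exp_add]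
      congr 1; ring
  simp_rw [h]
  rw [lintegral_const_mul _ (measurable_exponentialPDF _), lintegral_exponentialPDF_eq_one hr1,
    mul_one]

variable {Ω : Type*} [MeasurableSpace Ω] {P : Measure Ω}

/-- Independence settles finite products, and bounded convergence the infinite one. Writing `(1 + w
j)⁻¹` as the exponential of a negative logarithm turns the product into a sum in `[0, ∞]`, so no
summability is required. -/
lemma lintegral_negExp_tsum_mul_exp [IsProbabilityMeasure P] {G : ℕ → Ω → ℝ}
    (hG : ∀ j, Measurable (G j)) (hlaw : ∀ j, P.map (G j) = expMeasure 1) (hind : iIndepFun G P)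
    (w : ℕ → ℝ≥0∞) :
    ∫⁻ ω, negExp (∑' j, w j * ENNReal.ofReal (G j ω)) ∂P =
      negExp (∑' j, posLog (1 + w j)) := by
  have hm (j : ℕ) : Measurable fun x : ℝ => negExp (w j * ENNReal.ofReal x) :=
    measurable_negExp.comp (ENNReal.measurable_ofReal.const_mul _)
  have h1 : Tendsto (fun m => ∫⁻ ω, ∏ j ∈ Finset.range m, negExp (w j * ENNReal.ofReal (G j ω)) ∂P)
      atTop (𝓝 (∫⁻ ω, negExp (∑' j, w j * ENNReal.ofReal (G j ω)) ∂P)) := by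
    refine tendsto_lintegral_of_dominated_convergence (fun _ => 1)
      (fun m => Finset.measurable_prod _ fun j _ => (hm j).comp (hG j))
      (fun m => ae_of_all _ fun ω => Finset.prod_le_one' fun j _ => negExp_le_one _) (by simp)
      (ae_of_all _ fun ω => tendsto_prod_negExp _)
  refine tendsto_nhds_unique h1 ((tendsto_prod_negExp _).congr fun m => ?_)
  rw [lintegral_prod_eq_prod_lintegral_of_indepFun _
    (fun j ω => negExp (w j * ENNReal.ofReal (G j ω)))
    (hind.comp (fun j x => negExp (w j * ENNReal.ofReal x)) hm) (fun j => (hm j).comp (hG j))]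
  refine Finset.prod_congr rfl fun j _ => ?_
  rw [← lintegral_map (hm j) (hG j), hlaw, lintegral_negExp_expMeasure,
    negExp_posLog le_self_add]

lemma indepFun_comp_ne [IsProbabilityMeasure P] {G : ℕ → Ω → ℝ}
    (hG : ∀ j, Measurable (G j)) (hind : iIndepFun G P) (i : ℕ) {g : (({j // j ≠ i}) → ℝ) → ℝ≥0∞}
    (hg : Measurable g) :
    IndepFun (fun ω => g fun j => G j ω) (G i) P := by
  have h := indep_iSup_of_disjoint (m := fun j => MeasurableSpace.comap (G j) inferInstance)
    (fun j => (hG j).comap_le) hind (S := {j | j ≠ i}) (T := {i}) (by simp)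
  refine indep_of_indep_of_le_left (indep_of_indep_of_le_right h ?_) ?_
  · exact le_iSup₂_of_le i rfl le_rfl
  · change MeasurableSpace.comap (g ∘ fun ω (j : {j // j ≠ i}) => G j ω) _ ≤ _
    rw [← MeasurableSpace.comap_comp]
    refine (MeasurableSpace.comap_mono hg.comap_le).trans ?_
    rw [MeasurableSpace.pi, MeasurableSpace.comap_iSup]
    refine iSup_le fun j => ?_
    rw [MeasurableSpace.comap_comp]
    exact le_iSup₂_of_le (f := fun j (_ : j ∈ {j | j ≠ i}) =>
      MeasurableSpace.comap (G j) inferInstance) j.1 j.2 le_rfl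

/-- The probability that a Rayleigh faded signal exceeds a multiple of noise and interference. -/
lemma measure_mul_noise_add_interference_le [IsProbabilityMeasure P] {G : ℕ → Ω → ℝ}
    (hG : ∀ j, Measurable (G j)) (hlaw : ∀ j, P.map (G j) = expMeasure 1) (hind : iIndepFun G P)
    (θ W : ℝ≥0∞) (l : ℕ → ℝ≥0∞) (i : ℕ) :
    P {ω | θ * (W + ∑' j : {j // j ≠ i}, ENNReal.ofReal (G j ω) / l j) ≤ ENNReal.ofReal (G i ω)} =
      negExp (θ * W) * negExp (∑' j : {j // j ≠ i}, posLog (1 + θ / l j)) := by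
  let g (f : {j // j ≠ i} → ℝ) : ℝ≥0∞ := θ * (W + ∑' j : {j // j ≠ i}, ENNReal.ofReal (f j) / l j)
  have hg : Measurable g := by
    refine Measurable.const_mul (Measurable.const_add (Measurable.tsum fun j => ?_) _) _
    exact (ENNReal.measurable_ofReal.comp (measurable_pi_apply j)).div_const _
  have hgG : Measurable fun ω => g fun j => G j ω :=
    hg.comp (measurable_pi_lambda _ fun j => hG j)
  have hI := indepFun_comp_ne hG hind i hg
  rw [indepFun_iff_map_prod_eq_prod_map_map hgG.aemeasurable (hG i).aemeasurable, hlaw] at hI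
  have := isProbabilityMeasure_expMeasure one_pos
  have hs : MeasurableSet {q : ℝ≥0∞ × ℝ | q.1 ≤ ENNReal.ofReal q.2} :=
    measurableSet_le measurable_fst (ENNReal.measurable_ofReal.comp measurable_snd)
  have h1 : P {ω | θ * (W + ∑' j : {j // j ≠ i}, ENNReal.ofReal (G j ω) / l j) ≤
      ENNReal.ofReal (G i ω)} =
      P.map (fun ω => (g fun j => G j ω, G i ω)) {q : ℝ≥0∞ × ℝ | q.1 ≤ ENNReal.ofReal q.2} := by
    rw [Measure.map_apply (hgG.prodMk (hG i)) hs]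
    rfl
  -- Given noise and interference, the exponential tail of the signal makes the probability a
  -- Laplace transform.
  rw [h1, hI, Measure.prod_apply hs]
  have h2 (a : ℝ≥0∞) : expMeasure 1 (Prod.mk a ⁻¹' {q : ℝ≥0∞ × ℝ | q.1 ≤ ENNReal.ofReal q.2}) =
      negExp a := expMeasure_tail a
  simp_rw [h2]
  rw [lintegral_map measurable_negExp hgG]
  -- Weight `0` at `i` extends the sum to all indices, since `posLog 1 = 0`.
  let w (j : ℕ) : ℝ≥0∞ := {j | j ≠ i}.indicator (fun j => θ / l j) j
  have h3 (ω : Ω) : negExp (g fun j => G j ω) =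
      negExp (θ * W) * negExp (∑' j, w j * ENNReal.ofReal (G j ω)) := by
    rw [← negExp_add]
    congr 1
    simp only [g]
    rw [mul_add, ← ENNReal.tsum_mul_left]
    congr 1
    refine (tsum_subtype {j | j ≠ i} fun j => θ * (ENNReal.ofReal (G j ω) / l j)).trans ?_
    congr 1; ext j
    by_cases hj : j = i
    · simp [w, hj]
    · simp [w, hj, div_eq_mul_inv]; ring
  simp_rw [h3]
  rw [lintegral_const_mul' _ _ (negExp_ne_top _), lintegral_negExp_tsum_mul_exp hG hlaw hind w]
  congr 2
  refine Eq.trans ?_ (tsum_subtype {j | j ≠ i} fun j => posLog (1 + θ / l j)).symm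
  congr 1; ext j
  by_cases hj : j = i <;> simp [w, hj]

/-- Independence means that the joint law is a product measure, and currying a product over pairs
gives a product of products. -/
lemma iIndepFun_curry [IsProbabilityMeasure P] {G : ℕ × ℕ → Ω → ℝ}
    (hG : ∀ q, Measurable (G q)) (hind : iIndepFun G P) :
    iIndepFun (fun n ω j => G (n, j) ω) P := by
  have (q : ℕ × ℕ) : IsProbabilityMeasure (P.map (G q)) :=
    Measure.isProbabilityMeasure_map (hG q).aemeasurable
  have h1 (n : ℕ) : P.map (fun ω j => G (n, j) ω) =
      Measure.infinitePi fun j => P.map (G (n, j)) :=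
    (iIndepFun_iff_map_fun_eq_infinitePi_map fun j => hG (n, j)).1
      (hind.precomp (g := fun j => (n, j)) fun a b h => (Prod.mk.inj h).2)
  have hm (n : ℕ) : Measurable fun ω j => G (n, j) ω := measurable_pi_lambda _ fun j => hG (n, j)
  rw [iIndepFun_iff_map_fun_eq_infinitePi_map hm]
  simp_rw [h1]
  rw [← Measure.infinitePi_map_curry fun n j => P.map (G (n, j)),
    ← (iIndepFun_iff_map_fun_eq_infinitePi_map hG).1 hind,
    Measure.map_map (MeasurableEquiv.measurable _) (measurable_pi_lambda _ hG)]
  rfl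

/-- The probability that at least one of `tau` independent events of equal probability occurs. -/
lemma measure_biUnion_Icc_preimage [IsProbabilityMeasure P] {β : Type*} [MeasurableSpace β]
    {Y : ℕ → Ω → β} (hY : ∀ n, Measurable (Y n)) (hind : iIndepFun Y P) {s : Set β}
    (hs : MeasurableSet s) {p : ℝ≥0∞} (hp : ∀ n, P (Y n ⁻¹' s) = p) (tau : ℕ) :
    P (⋃ n ∈ Finset.Icc 1 tau, Y n ⁻¹' s) = 1 - (1 - p) ^ tau := by
  have hm : MeasurableSet (⋃ n ∈ Finset.Icc 1 tau, Y n ⁻¹' s) :=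
    Finset.measurableSet_biUnion _ fun n _ => hY n hs
  have hc : (⋃ n ∈ Finset.Icc 1 tau, Y n ⁻¹' s)ᶜ = ⋂ n ∈ Finset.Icc 1 tau, Y n ⁻¹' sᶜ := by
    simp [compl_iUnion, preimage_compl]
  rw [← ENNReal.sub_sub_cancel ENNReal.one_ne_top (prob_le_one (μ := P)
    (s := ⋃ n ∈ Finset.Icc 1 tau, Y n ⁻¹' s)), ← prob_compl_eq_one_sub hm, hc,
    hind.measure_inter_preimage_eq_mul _ fun n _ => hs.compl]
  congr 1
  rw [Finset.prod_congr rfl fun n _ => by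
    rw [preimage_compl, prob_compl_eq_one_sub (hY n hs), hp n]]
  simp

end Fading

/-! ### Conditional coverage probability and its moments. -/

section Coverage

open Filter Topology

instance isProbabilityMeasure_expMeasure_one : IsProbabilityMeasure (expMeasure 1) :=
  isProbabilityMeasure_expMeasure one_pos

/-- The signal to interference plus noise ratio at the receiver of the transmitter `x i`, for
deterministic transmitter positions `x` and fading powers `f`. -/
noncomputable def sinrAt (A α s : ℝ) (y : Plane) (i : ℕ) (x : ℕ → Plane) (f : ℕ → ℝ) : ℝ≥0∞ :=
  (ENNReal.ofReal (f i) / ENNReal.ofReal (A * ‖y‖ ^ α)) /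
    (ENNReal.ofReal s + ∑' j : {j : ℕ // j ≠ i},
      ENNReal.ofReal (f j) / ENNReal.ofReal (A * ‖x j - (x i + y)‖ ^ α))

lemma measurable_sinrAt (A α s : ℝ) (y : Plane) (i : ℕ) :
    Measurable fun q : (ℕ → Plane) × (ℕ → ℝ) => sinrAt A α s y i q.1 q.2 := by
  have h (j : ℕ) : Measurable fun q : (ℕ → Plane) × (ℕ → ℝ) => ENNReal.ofReal (q.2 j) := by
    fun_prop
  refine ((h i).div_const _).div (Measurable.const_add (Measurable.tsum fun j => ?_) _)
  refine (h j).div ?_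
  fun_prop

/-- The probability of coverage in a single transmission, given the transmitter positions. -/
noncomputable def coverProb (A α s T : ℝ) (y : Plane) (i : ℕ) (x : ℕ → Plane) : ℝ≥0∞ :=
  Measure.infinitePi (fun _ : ℕ => expMeasure 1) {f | ENNReal.ofReal T ≤ sinrAt A α s y i x f}

/-- The probability that the signal exceeds `θ` times noise plus interference, given the
transmitter positions. -/
noncomputable def signalProb (A α s θ : ℝ) (y : Plane) (i : ℕ) (x : ℕ → Plane) : ℝ≥0∞ :=
  negExp (ENNReal.ofReal θ * ENNReal.ofReal s) * negExp (∑' j : {j // j ≠ i},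
    posLog (1 + ENNReal.ofReal θ / ENNReal.ofReal (A * ‖x j - (x i + y)‖ ^ α)))

variable {A α s T θ : ℝ}

lemma measurable_coverProb (y : Plane) (i : ℕ) : Measurable (coverProb A α s T y i) :=
  measurable_measure_prodMk_left (measurableSet_le measurable_const (measurable_sinrAt A α s y i))

lemma coverProb_le_one (y : Plane) (i : ℕ) (x : ℕ → Plane) : coverProb A α s T y i x ≤ 1 :=
  prob_le_one

lemma infinitePi_signal_eq (y : Plane) (i : ℕ) (x : ℕ → Plane) :
    Measure.infinitePi (fun _ : ℕ => expMeasure 1) {f | ENNReal.ofReal θ * (ENNReal.ofReal s +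
      ∑' j : {j : ℕ // j ≠ i},
        ENNReal.ofReal (f j) / ENNReal.ofReal (A * ‖x j - (x i + y)‖ ^ α)) ≤
      ENNReal.ofReal (f i)} = signalProb A α s θ y i x := by
  have hind : iIndepFun (fun (j : ℕ) (f : ℕ → ℝ) => f j)
      (Measure.infinitePi fun _ : ℕ => expMeasure 1) :=
    iIndepFun_infinitePi (Ω := fun _ => ℝ) (X := fun _ u => u) fun _ => measurable_id
  have hm (j : ℕ) : Measurable fun f : ℕ → ℝ => f j := measurable_pi_apply j
  have hlaw (j : ℕ) : (Measure.infinitePi fun _ : ℕ => expMeasure 1).map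
      (fun f : ℕ → ℝ => f j) = expMeasure 1 :=
    Measure.infinitePi_map_eval (fun _ : ℕ => expMeasure 1) j
  exact measure_mul_noise_add_interference_le hm hlaw hind _ _
    (fun j => ENNReal.ofReal (A * ‖x j - (x i + y)‖ ^ α)) i

lemma ae_infinitePi_expMeasure_pos (i : ℕ) :
    ∀ᵐ f ∂(Measure.infinitePi fun _ : ℕ => expMeasure 1), 0 < f i := by
  have hlaw : (Measure.infinitePi fun _ : ℕ => expMeasure 1).map
      (fun f : ℕ → ℝ => f i) = expMeasure 1 :=
    Measure.infinitePi_map_eval (fun _ : ℕ => expMeasure 1) i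
  have hm : Measurable fun f : ℕ → ℝ => f i := measurable_pi_apply i
  have h := ae_expMeasure_pos
  rw [← hlaw] at h
  exact ae_of_ae_map hm.aemeasurable h

/-- The received signal is almost surely positive and finite, so both divisions can be cleared even
where noise plus interference is `0` or `∞`. -/
lemma coverProb_eq_signalProb (hA : 0 < A) (hT : 0 < T) {y : Plane} (hy : y ≠ 0) (i : ℕ)
    (x : ℕ → Plane) :
    coverProb A α s T y i x = signalProb A α s (T * (A * ‖y‖ ^ α)) y i x := by
  have hl : 0 < A * ‖y‖ ^ α := mul_pos hA (Real.rpow_pos_of_pos (norm_pos_iff.2 hy) α)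
  rw [coverProb, ← infinitePi_signal_eq]
  refine measure_congr (eventuallyEq_set.2 ?_)
  filter_upwards [ae_infinitePi_expMeasure_pos i] with f hf
  simp only [sinrAt]
  have hf' : ENNReal.ofReal (f i) / ENNReal.ofReal (A * ‖y‖ ^ α) ≠ 0 :=
    ENNReal.div_ne_zero.2 ⟨by simpa using hf, ENNReal.ofReal_ne_top⟩
  have hf'' : ENNReal.ofReal (f i) / ENNReal.ofReal (A * ‖y‖ ^ α) ≠ ∞ :=
    ENNReal.div_ne_top ENNReal.ofReal_ne_top (by simpa using hl)
  rw [ENNReal.le_div_iff_mul_le (Or.inr hf') (Or.inr hf''),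
    ENNReal.le_div_iff_mul_le (Or.inl (by simpa using hl)) (Or.inl ENNReal.ofReal_ne_top),
    ENNReal.ofReal_mul hT.le, mul_right_comm]

/-- At `y = 0` the signal is almost surely infinite, so finite noise plus interference suffices for
coverage. The event behind `signalProb` forces this finiteness for every `θ > 0`. -/
lemma signalProb_le_coverProb_zero (hα : α ≠ 0) (hθ : 0 < θ) (i : ℕ) (x : ℕ → Plane) :
    signalProb A α s θ 0 i x ≤ coverProb A α s T 0 i x := by
  rw [coverProb, ← infinitePi_signal_eq]
  refine measure_mono_ae ?_
  filter_upwards [ae_infinitePi_expMeasure_pos i] with f hf h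
  have hθ' : ENNReal.ofReal θ ≠ 0 := by simpa using hθ
  change ENNReal.ofReal T ≤ sinrAt A α s 0 i x f
  have hD : (ENNReal.ofReal s + ∑' j : {j : ℕ // j ≠ i},
      ENNReal.ofReal (f j) / ENNReal.ofReal (A * ‖x j - (x i + 0)‖ ^ α)) ≠ ∞ := by
    intro htop
    have h' : ENNReal.ofReal θ * (ENNReal.ofReal s + ∑' j : {j : ℕ // j ≠ i},
      ENNReal.ofReal (f j) / ENNReal.ofReal (A * ‖x j - (x i + 0)‖ ^ α)) ≤
      ENNReal.ofReal (f i) := h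
    rw [htop, ENNReal.mul_top hθ'] at h'
    exact ENNReal.ofReal_ne_top (top_le_iff.1 h')
  have hnum : ENNReal.ofReal (f i) / ENNReal.ofReal (A * ‖(0 : Plane)‖ ^ α) = ∞ := by
    rw [norm_zero, Real.zero_rpow hα, mul_zero, ENNReal.ofReal_zero, ENNReal.div_zero]
    simpa using hf
  rw [sinrAt, hnum, ENNReal.top_div_of_ne_top hD]
  exact le_top

lemma signalProb_pow (n : ℕ) (y : Plane) (i : ℕ) (x : ℕ → Plane) :
    signalProb A α s θ y i x ^ n = negExp (n * (ENNReal.ofReal θ * ENNReal.ofReal s)) *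
      negExp (∑' j : {j // j ≠ i}, interferenceExponent A α θ 0 n y (x j - x i)) := by
  rw [signalProb, mul_pow, ← negExp_nat_mul, ← negExp_nat_mul, ← ENNReal.tsum_mul_left]
  simp only [interferenceExponent, add_zero, sub_add_eq_sub_sub]

variable {Ω : Type*} [MeasurableSpace Ω] {P : Measure Ω} {X : ℕ → Ω → Plane}
  {F : ℕ → ℕ → ℕ → Ω → ℝ} {lam : ℝ≥0}

lemma IsPoissonProcess.lintegral_signalProb_pow [IsProbabilityMeasure P]
    (hX : IsPoissonProcess P X lam) (hA : 0 < A) (hα : 2 < α) (hs : 0 ≤ s) (hθ : 0 < θ) (n : ℕ)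
    (y : Plane) {B : Set Plane} (hB : MeasurableSet B) (hBbdd : Bornology.IsBounded B) :
    ∫⁻ p, signalProb A α s θ y p.2 (fun j => X j p.1) ^ n ∂campbellMeasure P X B =
      lam * volume B * ENNReal.ofReal (Real.exp (-(n * (θ * s))) *
        Real.exp (-(lam * (constK α n * (θ / A) ^ (2 / α))))) := by
  have hK := constK_nonneg hα n
  simp_rw [signalProb_pow]
  rw [lintegral_const_mul' _ _ (negExp_ne_top _),
    hX.lintegral_campbellMeasure_interference hA hα hθ n y hB hBbdd, mul_left_comm,
    ENNReal.ofReal_mul (Real.exp_pos _).le]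
  congr 2
  · rw [← negExp_ofReal (by positivity), ENNReal.ofReal_mul n.cast_nonneg,
      ENNReal.ofReal_mul hθ.le, ENNReal.ofReal_natCast]
  · rw [← negExp_ofReal (by positivity), ENNReal.ofReal_mul lam.coe_nonneg,
      ENNReal.ofReal_coe_nnreal]

lemma IsPoissonProcess.lintegral_coverProb_pow [IsProbabilityMeasure P]
    (hX : IsPoissonProcess P X lam) (hA : 0 < A) (hα : 2 < α) (hs : 0 ≤ s) (hT : 0 < T) (n : ℕ)
    (y : Plane) {B : Set Plane} (hB : MeasurableSet B) (hBbdd : Bornology.IsBounded B) :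
    ∫⁻ p, coverProb A α s T y p.2 (fun j => X j p.1) ^ n ∂campbellMeasure P X B =
      lam * volume B * ENNReal.ofReal (Real.exp (-(n * T * s * A * ‖y‖ ^ α)) *
        Real.exp (-(lam * constK α n * T ^ (2 / α) * ‖y‖ ^ 2))) := by
  have hα0 : 0 < α := by linarith
  by_cases hy : y = 0
  · subst hy
    rw [norm_zero, Real.zero_rpow hα0.ne']
    have hfin : (lam : ℝ≥0∞) * volume B ≠ ∞ :=
      ENNReal.mul_ne_top ENNReal.coe_ne_top hBbdd.measure_lt_top.ne
    simp only [mul_zero, neg_zero, Real.exp_zero, mul_one, ne_eq, OfNat.ofNat_ne_zero,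
      not_false_eq_true, zero_pow, ENNReal.ofReal_one]
    refine le_antisymm ?_ ?_
    · rw [← hX.campbellMeasure_univ hB, ← lintegral_one]
      exact lintegral_mono fun p => pow_le_one₀ zero_le (coverProb_le_one _ _ _)
    -- For `y = 0` the lower bound comes from letting `θ` decrease to `0` in
    -- `signalProb_le_coverProb_zero`.
    · have hlim : Tendsto (fun θ : ℝ => (lam : ℝ≥0∞) * volume B *
          ENNReal.ofReal (Real.exp (-(n * (θ * s))) *
          Real.exp (-(lam * (constK α n * (θ / A) ^ (2 / α)))))) (𝓝[>] 0)
          (𝓝 (lam * volume B * 1)) := by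
        refine ENNReal.Tendsto.const_mul ?_ (Or.inr hfin)
        have hc : Continuous fun θ : ℝ => ENNReal.ofReal (Real.exp (-(n * (θ * s))) *
            Real.exp (-(lam * (constK α n * (θ / A) ^ (2 / α))))) := by
          have : Continuous fun θ : ℝ => (θ / A) ^ (2 / α) :=
            (continuous_id.div_const A).rpow_const fun _ => Or.inr (by positivity)
          exact ENNReal.continuous_ofReal.comp (by fun_prop)
        have := (hc.tendsto 0).mono_left (nhdsWithin_le_nhds (s := Ioi 0))
        simpa [Real.zero_rpow (by positivity : 2 / α ≠ 0)] using this
      rw [mul_one] at hlim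
      refine le_of_tendsto hlim ?_
      filter_upwards [self_mem_nhdsWithin] with θ hθ
      rw [← hX.lintegral_signalProb_pow hA hα hs hθ n 0 hB hBbdd]
      exact lintegral_mono fun p =>
        pow_le_pow_left₀ zero_le (signalProb_le_coverProb_zero hα0.ne' hθ _ _) n
  · have hr : 0 < ‖y‖ := norm_pos_iff.2 hy
    have hrα : 0 < ‖y‖ ^ α := Real.rpow_pos_of_pos hr α
    simp_rw [coverProb_eq_signalProb hA hT hy]
    rw [hX.lintegral_signalProb_pow hA hα hs (by positivity) n y hB hBbdd]
    have h1 : (T * (A * ‖y‖ ^ α) / A) ^ (2 / α) = T ^ (2 / α) * ‖y‖ ^ 2 := by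
      have : T * (A * ‖y‖ ^ α) / A = T * ‖y‖ ^ α := by field_simp
      rw [this, Real.mul_rpow hT.le hrα.le, ← Real.rpow_mul hr.le, mul_div_cancel₀ _ hα0.ne',
        Real.rpow_two]
    rw [h1]
    congr 4 <;> ring_nf

/-- Fubini for the product law; it allows the positions to be frozen while the fading is averaged.
-/
lemma IndepFun.lintegral_comp_prodMk [IsProbabilityMeasure P] {β γ : Type*} [MeasurableSpace β]
    [MeasurableSpace γ] {Z : Ω → β} {Y : Ω → γ} (hZ : Measurable Z) (hY : Measurable Y)
    (h : IndepFun Z Y P) {g : β × γ → ℝ≥0∞} (hg : Measurable g) :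
    ∫⁻ ω, g (Z ω, Y ω) ∂P = ∫⁻ ω, ∫⁻ ω', g (Z ω, Y ω') ∂P ∂P := by
  have : IsProbabilityMeasure (P.map Y) := Measure.isProbabilityMeasure_map hY.aemeasurable
  rw [← lintegral_map hg (hZ.prodMk hY),
    (indepFun_iff_map_prod_eq_prod_map_map hZ.aemeasurable hY.aemeasurable).1 h,
    lintegral_prod _ hg.aemeasurable, lintegral_map hg.lintegral_prod_right' hZ]
  congr 1; ext ω
  have hgω : Measurable fun v => g (Z ω, v) := hg.comp measurable_prodMk_left
  rw [lintegral_map hgω hY]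

namespace IsMulticastNetwork

lemma measurable_position (hnet : IsMulticastNetwork P X F lam) :
    Measurable fun ω (i : ℕ) => X i ω :=
  measurable_pi_lambda _ hnet.poisson.measurable_point

lemma measurable_fading_pi (hnet : IsMulticastNetwork P X F lam) :
    Measurable fun ω (q : ℕ × ℕ × ℕ) => F q.1 q.2.1 q.2.2 ω :=
  measurable_pi_lambda _ fun q => hnet.measurable_fading q.1 q.2.1 q.2.2

/-- Given the transmitter positions, the coverage events of the different transmissions are
independent. -/
lemma measure_biUnion_sinrAt [IsProbabilityMeasure P] (hnet : IsMulticastNetwork P X F lam)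
    (tau : ℕ) (y : Plane) (i : ℕ) (x : ℕ → Plane) :
    P (⋃ n ∈ Finset.Icc 1 tau,
      {ω | ENNReal.ofReal T ≤ sinrAt A α s y i x fun j => F i j n ω}) =
      1 - (1 - coverProb A α s T y i x) ^ tau := by
  have hG (q : ℕ × ℕ) : Measurable (F i q.2 q.1) := hnet.measurable_fading i q.2 q.1
  -- The receiver is fixed and the pair is ordered with time first, so that currying groups the
  -- fading by transmission.
  have hind : iIndepFun (fun q : ℕ × ℕ => F i q.2 q.1) P :=
    hnet.indep_fading.precomp (g := fun q : ℕ × ℕ => (i, q.2, q.1)) fun a b h => by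
      simp only [Prod.mk.injEq, true_and] at h
      exact Prod.ext h.2 h.1
  have hY (n : ℕ) : Measurable fun ω j => F i j n ω :=
    measurable_pi_lambda _ fun j => hnet.measurable_fading i j n
  have hs : MeasurableSet {f : ℕ → ℝ | ENNReal.ofReal T ≤ sinrAt A α s y i x f} :=
    measurableSet_le measurable_const ((measurable_sinrAt A α s y i).comp measurable_prodMk_left)
  refine measure_biUnion_Icc_preimage (Y := fun n ω j => F i j n ω) hY (iIndepFun_curry hG hind) hs
    (fun n => ?_) tau
  have hn : iIndepFun (fun j => F i j n) P :=
    hind.precomp (g := fun j => (n, j)) fun a b h => (Prod.mk.inj h).2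
  rw [← Measure.map_apply (hY n) hs, (iIndepFun_iff_map_fun_eq_infinitePi_map
    fun j => hnet.measurable_fading i j n).1 hn, coverProb]
  simp_rw [hnet.map_fading]

/-- By linearity each point is treated separately, so the dependence between coverage at different
receivers plays no role. -/
lemma lintegral_tsum_coveredEvent [IsProbabilityMeasure P] (hnet : IsMulticastNetwork P X F lam)
    (tau : ℕ) (y : Plane) {B : Set Plane} (hB : MeasurableSet B) :
    ∫⁻ ω, ∑' i, B.indicator 1 (X i ω) *
      (coveredEvent (fun r => A * r ^ α) s T tau X F y i).indicator 1 ω ∂P =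
      ∫⁻ p, (1 - (1 - coverProb A α s T y p.2 (fun j => X j p.1)) ^ tau)
        ∂campbellMeasure P X B := by
  have hZ := hnet.measurable_position
  have hY := hnet.measurable_fading_pi
  have hcov (i : ℕ) : Measurable fun ω =>
      1 - (1 - coverProb A α s T y i (fun j => X j ω)) ^ tau :=
    ((((measurable_coverProb y i).comp hZ).const_sub 1).pow_const tau).const_sub 1
  let C (i : ℕ) : Set ((ℕ → Plane) × (ℕ × ℕ × ℕ → ℝ)) := ⋃ n ∈ Finset.Icc 1 tau,
    {q | ENNReal.ofReal T ≤ sinrAt A α s y i q.1 fun j => q.2 (i, j, n)}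
  have hC (i : ℕ) : MeasurableSet (C i) := by
    refine Finset.measurableSet_biUnion _ fun n _ => measurableSet_le measurable_const ?_
    have h : Measurable fun q : (ℕ → Plane) × (ℕ × ℕ × ℕ → ℝ) => fun j => q.2 (i, j, n) := by
      fun_prop
    exact (measurable_sinrAt A α s y i).comp (measurable_fst.prodMk h)
  have hE (i : ℕ) : coveredEvent (fun r => A * r ^ α) s T tau X F y i =
      (fun ω => ((fun i => X i ω), fun q : ℕ × ℕ × ℕ => F q.1 q.2.1 q.2.2 ω)) ⁻¹' C i := by
    simp only [C, preimage_iUnion]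
    rfl
  have hEm (i : ℕ) : MeasurableSet (coveredEvent (fun r => A * r ^ α) s T tau X F y i) := by
    rw [hE]
    exact (hZ.prodMk hY) (hC i)
  have hBm (i : ℕ) : Measurable fun ω => (B.indicator 1 (X i ω) : ℝ≥0∞) :=
    hnet.poisson.measurable_comp (measurable_one.indicator hB) i
  have hm1 (i : ℕ) : Measurable fun ω => (B.indicator 1 (X i ω) : ℝ≥0∞) *
      (coveredEvent (fun r => A * r ^ α) s T tau X F y i).indicator 1 ω :=
    (hBm i).mul (measurable_one.indicator (hEm i))
  have hm2 (i : ℕ) : Measurable fun ω => (B.indicator 1 (X i ω) : ℝ≥0∞) *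
      (1 - (1 - coverProb A α s T y i (fun j => X j ω)) ^ tau) := (hBm i).mul (hcov i)
  rw [hnet.poisson.lintegral_campbellMeasure hB (measurable_uncurry_nat hcov),
    MeasureTheory.lintegral_tsum fun i => (hm1 i).aemeasurable,
    MeasureTheory.lintegral_tsum fun i => (hm2 i).aemeasurable]
  congr 1; ext i
  have hg : Measurable fun q : (ℕ → Plane) × (ℕ × ℕ × ℕ → ℝ) =>
      (B.indicator 1 (q.1 i) : ℝ≥0∞) * (C i).indicator 1 q :=
    ((measurable_one.indicator hB).comp ((measurable_pi_apply i).comp measurable_fst)).mul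
      (measurable_one.indicator (hC i))
  have := IndepFun.lintegral_comp_prodMk hZ hY hnet.indep_position_fading hg
  rw [hE i]
  refine this.trans (lintegral_congr fun ω => ?_)
  let D : Set Ω := ⋃ n ∈ Finset.Icc 1 tau,
    {ω' | ENNReal.ofReal T ≤ sinrAt A α s y i (fun j => X j ω) fun j => F i j n ω'}
  have hD : (fun ω' => ((fun i => X i ω), fun q : ℕ × ℕ × ℕ => F q.1 q.2.1 q.2.2 ω')) ⁻¹' C i =
      D := by
    simp only [C, D, preimage_iUnion]
    rfl
  have hDm : MeasurableSet D := hD ▸ (measurable_const.prodMk hY) (hC i)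
  rw [← hnet.measure_biUnion_sinrAt tau y i, ← lintegral_indicator_one hDm,
    ← lintegral_const_mul _ (measurable_one.indicator hDm), ← hD]
  rfl

end IsMulticastNetwork

lemma one_sub_one_sub_pow (c : ℝ) (tau : ℕ) :
    1 - (1 - c) ^ tau = ∑ n ∈ Finset.Icc 1 tau, (-1) ^ (n + 1) * (tau.choose n : ℝ) * c ^ n := by
  have h := add_pow (-c) 1 tau
  rw [Finset.range_eq_Ico, Finset.sum_eq_sum_Ico_succ_bot (Nat.succ_pos tau)] at h
  have h2 : 1 - c = -c + 1 := by ring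
  rw [h2, h]
  simp only [pow_zero, one_pow, mul_one, Nat.choose_zero_right, Nat.cast_one, zero_add]
  rw [sub_add_eq_sub_sub, sub_self, zero_sub, ← Finset.sum_neg_distrib]
  refine Finset.sum_congr (by ext; simp) fun n _ => ?_
  rw [neg_pow c]
  ring

end Coverage

/-! ### The alternating sum over the number of transmissions. -/

theorem corollary1 {Ω : Type*} [MeasurableSpace Ω] (P : Measure Ω) [IsProbabilityMeasure P]
    (X : ℕ → Ω → Plane) (F : ℕ → ℕ → ℕ → Ω → ℝ) (lam : ℝ≥0) (hlam : 0 < lam)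
    (hnet : IsMulticastNetwork P X F lam)
    (A α : ℝ) (hA : 0 < A) (hα : 2 < α)
    (σ Pm T : ℝ) (hPm : 0 < Pm) (hT : 0 < T) (tau : ℕ) (y : Plane)
    (B : Set Plane) (hB : MeasurableSet B) (hBbdd : Bornology.IsBounded B)
    (hBpos : 0 < volume B) :
    (∀ n ∈ Finset.Icc 1 tau, IntegrableOn (integrandK α n) (Ioi (0 : ℝ))) ∧
    palmProb P X lam B
      (coveredEvent (fun r => A * r ^ α) (σ ^ 2 / Pm) T tau X F y) ≠ ∞ ∧
    (palmProb P X lam B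
      (coveredEvent (fun r => A * r ^ α) (σ ^ 2 / Pm) T tau X F y)).toReal =
      ∑ n ∈ Finset.Icc 1 tau, (-1 : ℝ) ^ (n + 1) * (tau.choose n : ℝ) *
        Real.exp (-((n : ℝ) * T * (σ ^ 2 / Pm) * A * ‖y‖ ^ α)) *
        Real.exp (-((lam : ℝ) * constK α n * T ^ (2 / α) * ‖y‖ ^ 2)) := by
  set s := σ ^ 2 / Pm with hs
  have hs0 : 0 ≤ s := by positivity
  have hmass : (lam : ℝ≥0∞) * volume B ≠ ∞ :=
    ENNReal.mul_ne_top ENNReal.coe_ne_top hBbdd.measure_lt_top.ne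
  have hmass0 : (lam : ℝ≥0∞) * volume B ≠ 0 :=
    mul_ne_zero (by exact_mod_cast hlam.ne') hBpos.ne'
  set Q := campbellMeasure P X B with hQ
  have hQuniv : Q univ = lam * volume B := hnet.poisson.campbellMeasure_univ hB
  have : IsFiniteMeasure Q := ⟨hQuniv ▸ hmass.lt_top⟩
  let c (p : Ω × ℕ) : ℝ≥0∞ := coverProb A α s T y p.2 fun j => X j p.1
  have hc1 (p) : c p ≤ 1 := coverProb_le_one _ _ _
  have hctop (p) : c p ≠ ∞ := ne_top_of_le_ne_top ENNReal.one_ne_top (hc1 p)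
  have hcm : Measurable c := measurable_uncurry_nat fun i =>
    (measurable_coverProb y i).comp hnet.measurable_position
  have hpow (n : ℕ) := hnet.poisson.lintegral_coverProb_pow hA hα hs0 hT n y hB hBbdd
  have hfin : ∫⁻ p, (1 - (1 - c p) ^ tau) ∂Q ≠ ∞ := by
    refine ne_top_of_le_ne_top (hQuniv ▸ hmass : Q univ ≠ ∞) ?_
    rw [← lintegral_one]
    exact lintegral_mono fun p => tsub_le_self
  -- The expansion of `1 - (1 - c) ^ tau` has signs, so it is integrated term by term over the
  -- reals, which requires each power to be integrable.
  have hint (n : ℕ) : Integrable (fun p => (c p ^ n).toReal) Q :=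
    integrable_toReal_of_lintegral_ne_top (hcm.pow_const n).aemeasurable (by
      rw [hpow n]; exact ENNReal.mul_ne_top hmass ENNReal.ofReal_ne_top)
  refine ⟨fun n _ => integrableOn_integrandK hα n, ?_, ?_⟩
  · rw [palmProb, hnet.lintegral_tsum_coveredEvent tau y hB]
    exact ENNReal.div_ne_top hfin hmass0
  · rw [palmProb, hnet.lintegral_tsum_coveredEvent tau y hB, ENNReal.toReal_div]
    have h1 : (∫⁻ p, (1 - (1 - c p) ^ tau) ∂Q).toReal =
        ∫ p, ∑ n ∈ Finset.Icc 1 tau, (-1) ^ (n + 1) * (tau.choose n : ℝ) * (c p ^ n).toReal ∂Q := by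
      rw [← integral_toReal ((((hcm.const_sub 1).pow_const tau).const_sub 1).aemeasurable)
        (ae_of_all _ fun p => (tsub_le_self.trans_lt ENNReal.one_lt_top))]
      refine integral_congr_ae (ae_of_all _ fun p => ?_)
      simp only [ENNReal.toReal_pow]
      rw [← one_sub_one_sub_pow, ENNReal.toReal_sub_of_le (pow_le_one₀ zero_le tsub_le_self)
        ENNReal.one_ne_top, ENNReal.toReal_pow, ENNReal.toReal_sub_of_le (hc1 p)
        ENNReal.one_ne_top, ENNReal.toReal_one]
    rw [h1, integral_finsetSum _ fun n _ => (hint n).const_mul _, Finset.sum_div]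
    refine Finset.sum_congr rfl fun n _ => ?_
    rw [integral_const_mul, integral_toReal (hcm.pow_const n).aemeasurable
      (ae_of_all _ fun p => ENNReal.pow_lt_top (hctop p).lt_top), hpow n, ENNReal.toReal_mul,
      ENNReal.toReal_ofReal (by positivity)]
    have h0 := ENNReal.toReal_ne_zero.2 ⟨hmass0, hmass⟩
    field_simp
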